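/- Let $T,d\ge 1$ and let $\boldsymbol X_t=\boldsymbol f_t+\boldsymbol\epsilon_t\in\mathbb R^d$, $t=1,\dots,T$, where $\boldsymbol f_t$ is a deterministic piecewise-constant signal with exactly $N\ge 0$ change-points $0=r_0<r_1<\dots<r_N<r_{N+1}=T$ (that is, $\boldsymbol f_t$ is constant for $r_{j}<t\le r_{j+1}$, and $\boldsymbol f_{r_j}\ne\boldsymbol f_{r_j+1}$ for $1\le j\le N$), and $\boldsymbol\epsilon_1,\dots,\boldsymbol\epsilon_T$ are independent with law $\mathcal N_d(\boldsymbol 0,\Sigma)$, $\Sigma$ positive definite with diagonal entries at most $\sigma^2$ (for instance $\sigma=1$ when all components have unit variance). Let $L$ be one of the mean-dominant norms $L_2(x)=\sqrt{\tfrac1d\sum_{i=1}^d x_i^2}$, $L_\infty(x)=\max_i|x_i|$. Put $\tilde\delta_j=r_{j+1}-r_j$, $\delta_T=\min_{0\le j\le N}\tilde\delta_j$, $\boldsymbol\Delta_j=|\boldsymbol f_{r_j+1}-\boldsymbol f_{r_j}|$ (componentwise) and $\underline f_T=\inf_{1\le j\le N}L(\boldsymbol\Delta_j)$ ($=\infty$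 if $N=0$). For $s\le b<e$ and $\ell=e-s+1$ let $$\tilde X^{b,k}_{s,e}=\sqrt{\tfrac{e-b}{\ell(b-s+1)}}\sum_{t=s}^bX_{t,k}-\sqrt{\tfrac{b-s+1}{\ell(e-b)}}\sum_{t=b+1}^eX_{t,k},\qquad C^b_{s,e}=L\big((|\tilde X^{b,k}_{s,e}|)_{k=1}^d\big).$$ MDAIS with expansion parameter $\lambda_T\in\mathbb N$, $\lambda_T\ge1$, and threshold $\zeta_{T,d}$ is the following recursive procedure, started on $[1,T]$. On $[s,e]$: stop if $e-s<1$. Otherwise let $d_{s,e}=\operatorname{argmax}_{s\le t<e}L(|\boldsymbol X_{t+1}-\boldsymbol X_t|)$, $K^l=\lceil (d_{s,e}-s+1)/\lambda_T\rceil$, $K^r=\lceil(e-d_{s,e}+1)/\lambda_T\rceil$, $K^{\min}=\min(K^l,K^r)$, $K^{\max}=\max(K^l,K^r)$, $c^l_m=\max(d_{s,e}-m\lambda_T,s)$, $c^r_k=\min(d_{s,e}+k\lambda_T-1,e)$, and go through the intervals $[c^l_0,c^r_1],[c^l_1,c^r_1],[c^l_1,c^r_2],[c^l_2,c^r_2],\dots,[c^l_{K^{\min}},c^r_{K^{\min}}]$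 and then $[c^l_m,c^r_m]$, $m=K^{\min}+1,\dots,K^{\max}$, in this order. At the first interval $[s^*,e^*]$ with $\max_{s^*\le b<e^*}C^b_{s^*,e^*}>\zeta_{T,d}$, record the maximiser $b$ as an estimated change-point obtained in $[s^*,e^*]$ and apply the procedure to $[s,s^*]$ and to $[e^*,e]$; if there is no such interval, stop. (In an argmax over times the first maximiser is taken.) Let $\hat r_1<\dots<\hat r_{\hat N}$ be the estimates, and let $[s_j,e_j]$ be the interval in which $\hat r_j$ is obtained. Let $n\ge 3/2$ be a constant. Let (A1) be the event that each time MDAIS is applied to an interval $[s,e]$ containing a change-point $s\le r_j<e$, one has $$d_{s,e}\in\Big[1,r_1+\tfrac{\tilde\delta_1}2-\tfrac{3\delta_T}{4n}\Big]\cup\Big[r_N-\tfrac{\tilde\delta_{N-1}}2+\tfrac{3\delta_T}{4n},T-1\Big]\cup\bigcup_{j=2}^{N-1}\Big[r_j-\tfrac{\tilde\delta_{j-1}}2+\tfrac{3\delta_T}{4n},\,r_j+\tfrac{\tilde\delta_j}2-\tfrac{3\delta_T}{4n}\Big].$$ Then, for every $n\ge 3/2$ and $\sigma>0$, there are positive constants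 $\underline C_M,C_1,C_2,C_3,C_4$ with $C_1<C_2\underline C_M$, and a $T_0$, all depending only on $n$ and $\sigma$ (so not on $T$, $d$, $\Sigma$ or the signal), such that the following holds for all $T\ge T_0$ and all $d\ge1$. If $$\text{(A4)}\quad\sqrt{\delta_T}\,\underline f_T\ge\underline C_M\sqrt{\log(Td^{1/4})},\qquad 1\le\lambda_T\le\frac{\delta_T}{2n},\qquad C_1\sqrt{\log(Td^{1/4})}\le\zeta_{T,d}<C_2\sqrt{\delta_T}\,\underline f_T,$$ then, with probability at least $1-C_4/T$, either (A1) fails or $$\hat N=N\quad\text{and}\quad\max_{1\le j\le N}|\hat r_j-r_j|\,\alpha_j^2\le C_3\log(Td^{1/4}).$$ Here $\alpha_j=|f_{r_{j+1},q_j}-f_{r_j,q_j}|$ with $q_j\in\operatorname{argmax}_{k}|\tilde X^{\hat r_j,k}_{s_j,e_j}|$ (any maximiser) if $L=L_\infty$, and $\alpha_j=L_2(\boldsymbol\Delta_j)$ if $L=L_2$. In particular, if (A1) holds almost surely, then the displayed conclusion has probability at least $1-C_4/T$. -/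

import Mathlib

open MeasureTheory ProbabilityTheory
open scoped ENNReal

namespace ChangePoint

/-! ### The signal -/

/-- `f 1, …, f T` is a `d`-dimensional piecewise-constant signal with exactly the `N`
change-points `r 1 < … < r N`, where `r 0 = 0` and `r (N + 1) = T`.  Times are natural numbers;
the values of `f` outside `{1, …, T}` and of `r` outside `{0, …, N + 1}` play no role. -/
structure IsPiecewiseConstant {d : ℕ} (T N : ℕ) (r : ℕ → ℕ) (f : ℕ → Fin d → ℝ) : Prop where
  r_zero : r 0 = 0
  r_last : r (N + 1) = T
  r_lt : ∀ j ≤ N, r j < r (j + 1)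
  const : ∀ j ≤ N, ∃ μ : Fin d → ℝ, ∀ t, r j < t → t ≤ r (j + 1) → f t = μ
  jump : ∀ j, 1 ≤ j → j ≤ N → f (r j) ≠ f (r j + 1)

/-- The distance `r (j + 1) - r j` between consecutive change-points. -/
def gap (r : ℕ → ℕ) (j : ℕ) : ℕ := r (j + 1) - r j

/-- The minimum distance `δ_T = min_{j = 0, …, N} (r (j + 1) - r j)`. -/
def minGap (N : ℕ) (r : ℕ → ℕ) : ℕ :=
  (Finset.range (N + 1)).inf' Finset.nonempty_range_add_one (gap r)

/-- The vector `|f (r j + 1) - f (r j)|` of componentwise jump magnitudes. -/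
def jumpVec {d : ℕ} (f : ℕ → Fin d → ℝ) (r : ℕ → ℕ) (j : ℕ) : Fin d → ℝ :=
  fun k => |f (r j + 1) k - f (r j) k|

/-- The two mean-dominant norms. -/
inductive AggNorm where
  | L2
  | Linf

/-- `L_2 x = √((1/d) ∑ x_i²)` and `L_∞ x = sup |x_i|`. -/
noncomputable def AggNorm.eval {d : ℕ} : AggNorm → (Fin d → ℝ) → ℝ
  | .L2, x => √((1 / (d : ℝ)) * ∑ i, x i ^ 2)
  | .Linf, x => ⨆ i, |x i|

/-- The minimum jump magnitude `inf_{j = 1, …, N} L (Δ_j)`; it is `∞` if there is no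
change-point (`N = 0`), and a nonnegative real number otherwise. -/
noncomputable def minJump {d : ℕ} (L : AggNorm) (N : ℕ) (r : ℕ → ℕ) (f : ℕ → Fin d → ℝ) :
    ℝ≥0∞ :=
  ⨅ j ∈ Finset.Icc 1 N, ENNReal.ofReal (L.eval (jumpVec f r j))

/-- The jump size `α_j` entering the location error: the jump of the coordinate `q` for `L_∞`,
and `L_2` of the vector of jumps for `L_2`. -/
noncomputable def jumpSize {d : ℕ} (L : AggNorm) (f : ℕ → Fin d → ℝ) (r : ℕ → ℕ) (j : ℕ)
    (q : Fin d) : ℝ :=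
  match L with
  | .Linf => |f (r (j + 1)) q - f (r j) q|
  | .L2 => AggNorm.L2.eval (jumpVec f r j)

/-! ### The contrast function -/

/-- The CUSUM statistic of the univariate sequence `x` on `[s, e]` at the location `b`, for
`s ≤ b < e`. -/
noncomputable def cusum (x : ℕ → ℝ) (s e b : ℕ) : ℝ :=
  √(((e : ℝ) - b) / (((e : ℝ) - s + 1) * ((b : ℝ) - s + 1))) * ∑ t ∈ Finset.Icc s b, x t
    - √(((b : ℝ) - s + 1) / (((e : ℝ) - s + 1) * ((e : ℝ) - b))) *
        ∑ t ∈ Finset.Icc (b + 1) e, x t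

/-- The absolute CUSUM statistic of the `k`-th component of the data `X`. -/
noncomputable def absCusum {d : ℕ} (X : ℕ → Fin d → ℝ) (s e b : ℕ) (k : Fin d) : ℝ :=
  |cusum (fun t => X t k) s e b|

/-- The contrast: the componentwise absolute CUSUMs, aggregated by the norm. -/
noncomputable def contrast {d : ℕ} (L : AggNorm) (X : ℕ → Fin d → ℝ) (s e b : ℕ) : ℝ :=
  L.eval (absCusum X s e b)

/-! ### The algorithm MDAIS -/

/-- The (first) maximiser of `g` on the finite set `A` of times; only used for nonempty `A`. -/
noncomputable def argmax (A : Finset ℕ) (g : ℕ → ℝ) : ℕ :=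
  sInf {t | t ∈ A ∧ ∀ u ∈ A, g u ≤ g t}

/-- The location in `{s, …, e - 1}` of the largest difference of consecutive observations. -/
noncomputable def largestDiff {d : ℕ} (L : AggNorm) (X : ℕ → Fin d → ℝ) (s e : ℕ) : ℕ :=
  argmax (Finset.Ico s e) (fun t => L.eval (fun k => |X (t + 1) k - X t k|))

/-- `K^l = ⌈(p - s + 1) / lam⌉` for the starting point `p` in `[s, e]`. -/
noncomputable def numLeft (lam s p : ℕ) : ℕ := ⌈((p : ℝ) - s + 1) / lam⌉₊

/-- `K^r = ⌈(e - p + 1) / lam⌉` for the starting point `p` in `[s, e]`. -/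
noncomputable def numRight (lam e p : ℕ) : ℕ := ⌈((e : ℝ) - p + 1) / lam⌉₊

/-- The left end-points `c^l_m = max (p - m lam) s`. -/
def leftPt (lam s p m : ℕ) : ℕ := max (p - m * lam) s

/-- The right end-points `c^r_k = min (p + k lam - 1) e`, for `k ≥ 1`. -/
def rightPt (lam e p k : ℕ) : ℕ := min (p + k * lam - 1) e

/-- The `j`-th interval, `1 ≤ j ≤ K^l + K^r`, around the starting point `p` in `[s, e]`.  The
left end-points are, in this order, `c^l_0, c^l_1, c^l_1, c^l_2, …, c^l_{Kmin-1}, c^l_{Kmin}`,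
then `c^l_{Kmin+1}, …, c^l_{Kmax}`; the right ones are
`c^r_1, c^r_1, c^r_2, c^r_2, …, c^r_{Kmin}, c^r_{Kmin}`, then `c^r_{Kmin+1}, …, c^r_{Kmax}`. -/
noncomputable def searchInterval (lam s e p j : ℕ) : ℕ × ℕ :=
  let Kmin := min (numLeft lam s p) (numRight lam e p)
  if j ≤ 2 * Kmin then (leftPt lam s p (j / 2), rightPt lam e p ((j + 1) / 2))
  else (leftPt lam s p (j - Kmin), rightPt lam e p (j - Kmin))

open Classical in
/-- The first of the intervals around the largest difference of `[s, e]` on which the maximum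
of the contrast exceeds the threshold `ζ`, if there is one.  (An interval of one point has no
candidate location, hence no detection.) -/
noncomputable def firstDetection {d : ℕ} (L : AggNorm) (X : ℕ → Fin d → ℝ) (lam : ℕ) (ζ : ℝ)
    (s e : ℕ) : Option (ℕ × ℕ) :=
  let p := largestDiff L X s e
  ((List.range' 1 (numLeft lam s p + numRight lam e p)).map (searchInterval lam s e p)).find?
    (fun I => decide (∃ b ∈ Finset.Ico I.1 I.2, ζ < contrast L X I.1 I.2 b))

theorem firstDetection_bounds {d : ℕ} {L : AggNorm} {X : ℕ → Fin d → ℝ} {lam : ℕ} {ζ : ℝ}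
    {s e : ℕ} {I : ℕ × ℕ} (h : firstDetection L X lam ζ s e = some I) :
    s ≤ I.1 ∧ I.1 < I.2 ∧ I.2 ≤ e := by
  unfold firstDetection at h
  have h1 := List.find?_some h
  have h2 := List.mem_of_find?_eq_some h
  simp only [decide_eq_true_eq, Finset.mem_Ico] at h1
  obtain ⟨b, hb, -⟩ := h1
  obtain ⟨j, -, rfl⟩ := List.mem_map.1 h2
  refine ⟨?_, by omega, ?_⟩
  · unfold searchInterval leftPt
    dsimp only
    split_ifs <;> exact le_max_right _ _
  · unfold searchInterval rightPt
    dsimp only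
    split_ifs <;> exact min_le_right _ _

/-- An estimated change-point `loc` together with the interval `[left, right]` in which it was
obtained. -/
structure Detection where
  loc : ℕ
  left : ℕ
  right : ℕ

/-- MDAIS on `[s, e]` with expansion parameter `lam` and threshold `ζ`.  The output is listed by
increasing location: the recursive call on `[s, left]` only produces locations `< left`, the one
on `[right, e]` only locations `≥ right`, and `left ≤ loc < right`. -/
noncomputable def mdais {d : ℕ} (L : AggNorm) (X : ℕ → Fin d → ℝ) (lam : ℕ) (ζ : ℝ) (s e : ℕ) :
    List Detection :=
  if s < e then
    match _h : firstDetection L X lam ζ s e with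
    | none => []
    | some I =>
      mdais L X lam ζ s I.1
        ++ [⟨argmax (Finset.Ico I.1 I.2) (contrast L X I.1 I.2), I.1, I.2⟩]
        ++ mdais L X lam ζ I.2 e
  else []
termination_by e - s
decreasing_by
  all_goals
    have := firstDetection_bounds _h
    omega

/-- `IsCall L X lam ζ T s e`: MDAIS, started on `[1, T]`, is at some stage applied to `[s, e]`. -/
inductive IsCall {d : ℕ} (L : AggNorm) (X : ℕ → Fin d → ℝ) (lam : ℕ) (ζ : ℝ) (T : ℕ) :
    ℕ → ℕ → Prop
  | start : IsCall L X lam ζ T 1 T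
  | goLeft {s e : ℕ} {I : ℕ × ℕ} : IsCall L X lam ζ T s e → s < e →
      firstDetection L X lam ζ s e = some I → IsCall L X lam ζ T s I.1
  | goRight {s e : ℕ} {I : ℕ × ℕ} : IsCall L X lam ζ T s e → s < e →
      firstDetection L X lam ζ s e = some I → IsCall L X lam ζ T I.2 e

/-! ### The location of the largest difference -/

/-- The set of locations (for `N ≥ 1` change-points) in which the largest difference has to lie:
`[1, r_1 + δ̃_1/2 - 3δ/(4n)] ∪ [r_N - δ̃_{N-1}/2 + 3δ/(4n), T - 1] ∪
⋃_{j=2}^{N-1} [r_j - δ̃_{j-1}/2 + 3δ/(4n), r_j + δ̃_j/2 - 3δ/(4n)]`, where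
`δ̃_j = r_{j+1} - r_j` and `δ` is their minimum. -/
def AdmissibleStart (n : ℝ) (T N : ℕ) (r : ℕ → ℕ) (p : ℕ) : Prop :=
  let c : ℝ := 3 * (minGap N r : ℝ) / (4 * n)
  (1 ≤ p ∧ (p : ℝ) ≤ r 1 + (gap r 1 : ℝ) / 2 - c) ∨
  ((r N : ℝ) - (gap r (N - 1) : ℝ) / 2 + c ≤ p ∧ p ≤ T - 1) ∨
  ∃ j, 2 ≤ j ∧ j ≤ N - 1 ∧ (r j : ℝ) - (gap r (j - 1) : ℝ) / 2 + c ≤ p ∧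
    (p : ℝ) ≤ r j + (gap r j : ℝ) / 2 - c

/-- Every time the algorithm is applied to an interval `[s, e]` that contains a change-point
(that is, `s ≤ r j < e`, so that the change is visible in `[s, e]`), the location of the largest
difference is admissible. -/
def LargestDiffCondition {d : ℕ} (n : ℝ) (L : AggNorm) (X : ℕ → Fin d → ℝ) (lam : ℕ) (ζ : ℝ)
    (T N : ℕ) (r : ℕ → ℕ) : Prop :=
  ∀ s e : ℕ, IsCall L X lam ζ T s e → (∃ j, 1 ≤ j ∧ j ≤ N ∧ s ≤ r j ∧ r j < e) →
    AdmissibleStart n T N r (largestDiff L X s e)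

/-- The number of estimated change-points is `N`, and each estimate `r̂_j`, obtained in the
interval `[s_j, e_j]`, satisfies `|r̂_j - r_j| α_j² ≤ B`; for `L_∞` this is required with every
coordinate `q` that maximises the absolute CUSUM on `[s_j, e_j]` at `r̂_j`. -/
def Recovers {d : ℕ} (L : AggNorm) (X : ℕ → Fin d → ℝ) (out : List Detection) (N : ℕ)
    (r : ℕ → ℕ) (f : ℕ → Fin d → ℝ) (B : ℝ) : Prop :=
  out.length = N ∧
  ∀ j, 1 ≤ j → j ≤ N → ∀ D : Detection, out[j - 1]? = some D →
    ∀ q : Fin d, (∀ k, absCusum X D.left D.right D.loc k ≤ absCusum X D.left D.right D.loc q) →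
      |(D.loc : ℝ) - r j| * jumpSize L f r j q ^ 2 ≤ B

/-- `log (T d^{1/4})`. -/
noncomputable def logTd (T d : ℕ) : ℝ := Real.log ((T : ℝ) * (d : ℝ) ^ (1 / 4 : ℝ))

end ChangePoint

namespace ChangePoint

/-! Randomness enters only through the event that every CUSUM of every noise component on every
subinterval is at most c = 4σ√log(T d^{1/4}) (`CusumBounded`). The CUSUM weights have unit ℓ² norm,
so each of these statistics is sub-Gaussian with variance proxy at most σ², and a union bound over
at most T³d of them leaves a failure probability of at most 2/T (`measureReal_not_cusumBounded_le`,
`union_bound_le`). On this event the argument is deterministic.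

Detection. Put u = δ_T/(2n) ≥ λ_T. An interval without a change has contrast at most c ≤ ζ and is
never selected. Admissibility of the starting point p makes one visible change closer to p than all
other visible ones by a margin 3u (`exists_closest_change`). Hence some symmetric expansion of p
holds that change at depth at least u/2 and ends at distance at least u/2 from the others
(`exists_isolating_expansion`); at this depth the signal condition forces a detection. The search
intervals are nested, so the first detecting interval lies inside that expansion. It must contain
the change, and the remaining changes are again at depth at least u/2 in the two recursive calls.
This invariant drives the induction `DetectionRegime.forall₂_mdais`.

Localisation. For s ≤ b < r < e, splitting three blocks in two ways gives C_{s,e}(b)² +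
C_{b+1,e}(r)² = C_{s,e}(r)² + C_{s,r}(b)² (`cusum_sq_add_cusum_sq`). If r is the only change and b
beats r on [s,e], then the CUSUM on [b+1,e], which carries the jump g, is at most the one on [s,r],
which is pure noise. With x = |b - r| and y the length beyond r this says √(xy/(x+y)) g ≤ 2c, while
the detection itself shows y g² ≥ 81c²; so x is the short side and x g² ≤ 8c²
(`IsQuadratic.dist_mul_sq_le`). The comparison holds for any weighted ℓ² seminorm: L_2 itself, and
for L_∞ the single coordinate that attains the contrast at the estimate. -/

theorem argmax_spec {A : Finset ℕ} (hA : A.Nonempty) (g : ℕ → ℝ) :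
    argmax A g ∈ A ∧ ∀ u ∈ A, g u ≤ g (argmax A g) := by
  obtain ⟨x, hx, hmax⟩ := A.exists_max_image g hA
  exact Nat.sInf_mem (s := {t | t ∈ A ∧ ∀ u ∈ A, g u ≤ g t}) ⟨x, hx, hmax⟩

/-! ### Seminorms dominated by the supremum norm -/

/-- A seminorm on `ℝ^d` which is bounded by the supremum norm and only depends on the absolute
values of the coordinates. -/
structure IsMeanDominant {d : ℕ} (G : (Fin d → ℝ) → ℝ) : Prop where
  nonneg : ∀ x, 0 ≤ G x
  le_of_abs_le : ∀ (x : Fin d → ℝ) (c : ℝ), 0 ≤ c → (∀ k, |x k| ≤ c) → G x ≤ c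
  add_le : ∀ x y, G (fun k => x k + y k) ≤ G x + G y
  smul : ∀ (c : ℝ) x, G (fun k => c * x k) = |c| * G x
  abs : ∀ x, G (fun k => |x k|) = G x

/-- A mean-dominant seminorm which is a weighted `ℓ²` norm: it respects coordinatewise
Pythagorean identities. -/
structure IsQuadratic {d : ℕ} (G : (Fin d → ℝ) → ℝ) : Prop extends IsMeanDominant G where
  le_of_sq_add_sq : ∀ x y v w : Fin d → ℝ, (∀ k, x k ^ 2 + w k ^ 2 = y k ^ 2 + v k ^ 2) →
    G y ≤ G x → G w ≤ G v

theorem L2_eval_eq_norm {d : ℕ} (x : Fin d → ℝ) :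
    AggNorm.L2.eval x = √(1 / (d : ℝ)) * ‖WithLp.toLp 2 x‖ := by
  rw [EuclideanSpace.norm_eq, AggNorm.eval, Real.sqrt_mul (by positivity)]
  simp

theorem isQuadratic_L2 {d : ℕ} : IsQuadratic (AggNorm.L2.eval (d := d)) where
  nonneg x := by rw [L2_eval_eq_norm]; positivity
  le_of_abs_le x c hc h := by
    rw [AggNorm.eval]
    refine Real.sqrt_le_iff.2 ⟨hc, ?_⟩
    have h1 : ∑ i, x i ^ 2 ≤ (d : ℝ) * c ^ 2 := by
      calc ∑ i, x i ^ 2 ≤ ∑ _i : Fin d, c ^ 2 :=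
            Finset.sum_le_sum fun i _ => sq_le_sq.2 ((h i).trans (le_abs_self c))
        _ = _ := by simp
    rcases Nat.eq_zero_or_pos d with hd | hd
    · subst hd; simp; positivity
    · have hd' : (0 : ℝ) < d := by exact_mod_cast hd
      rw [one_div, inv_mul_le_iff₀ hd']
      exact h1
  add_le x y := by
    simp only [L2_eval_eq_norm, ← mul_add]
    gcongr
    exact norm_add_le (WithLp.toLp 2 x) (WithLp.toLp 2 y)
  smul c x := by
    simp only [L2_eval_eq_norm]
    have : WithLp.toLp 2 (fun k => c * x k) = c • WithLp.toLp 2 x := rfl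
    rw [this, norm_smul, Real.norm_eq_abs]
    ring
  abs x := by simp [AggNorm.eval]
  le_of_sq_add_sq x y v w h hxy := by
    unfold AggNorm.eval at *
    have h0 : (0 : ℝ) ≤ 1 / (d : ℝ) := by positivity
    have hs : ∀ z : Fin d → ℝ, 0 ≤ 1 / (d : ℝ) * ∑ i, z i ^ 2 := fun z =>
      mul_nonneg h0 (Finset.sum_nonneg fun i _ => sq_nonneg _)
    rw [Real.sqrt_le_sqrt_iff (hs _)] at hxy
    apply Real.sqrt_le_sqrt
    have h1 : 1 / (d : ℝ) * ∑ k, (x k ^ 2 + w k ^ 2) = 1 / (d : ℝ) * ∑ k, (y k ^ 2 + v k ^ 2) := by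
      simp only [h]
    simp only [Finset.sum_add_distrib, mul_add] at h1
    linarith

theorem isQuadratic_coord {d : ℕ} (q : Fin d) : IsQuadratic (fun x : Fin d → ℝ => |x q|) where
  nonneg x := abs_nonneg _
  le_of_abs_le x c _ h := h q
  add_le x y := abs_add_le _ _
  smul c x := abs_mul _ _
  abs x := abs_abs _
  le_of_sq_add_sq x y v w h hxy := by
    have h1 := h q
    have h2 := sq_le_sq.2 hxy
    exact sq_le_sq.1 (by linarith)

theorem isMeanDominant_eval {d : ℕ} (L : AggNorm) : IsMeanDominant (L.eval (d := d)) := by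
  cases L with
  | L2 => exact isQuadratic_L2.toIsMeanDominant
  | Linf =>
    have hb : ∀ x : Fin d → ℝ, BddAbove (Set.range fun i => |x i|) := fun x =>
      (Set.finite_range _).bddAbove
    refine ⟨fun x => Real.iSup_nonneg fun i => abs_nonneg _,
      fun x c hc h => Real.iSup_le h hc, fun x y => ?_, fun c x => ?_, fun x => ?_⟩
    · refine Real.iSup_le (fun i => (abs_add_le _ _).trans ?_)
        (add_nonneg (Real.iSup_nonneg fun i => abs_nonneg _)
          (Real.iSup_nonneg fun i => abs_nonneg _))
      exact add_le_add (le_ciSup (hb x) i) (le_ciSup (hb y) i)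
    · simp only [AggNorm.eval, abs_mul]
      rw [Real.mul_iSup_of_nonneg (abs_nonneg c)]
    · simp [AggNorm.eval]

/-! ### Algebra of the CUSUM statistic -/

/-- With a single square root in front of a difference of block means, squares of CUSUMs become
rational expressions in the block lengths and sums. -/
theorem cusum_eq {x : ℕ → ℝ} {s e b : ℕ} (hb : s ≤ b) (he : b < e) :
    cusum x s e b = √(((b : ℝ) - s + 1) * ((e : ℝ) - b) / ((e : ℝ) - s + 1)) *
      ((∑ t ∈ Finset.Icc s b, x t) / ((b : ℝ) - s + 1)
        - (∑ t ∈ Finset.Icc (b + 1) e, x t) / ((e : ℝ) - b)) := by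
  have h1 : (s : ℝ) ≤ b := by exact_mod_cast hb
  have h2 : (b : ℝ) < e := by exact_mod_cast he
  have p1 : (0 : ℝ) < (b : ℝ) - s + 1 := by linarith
  have p2 : (0 : ℝ) < (e : ℝ) - b := by linarith
  have p3 : (0 : ℝ) < (e : ℝ) - s + 1 := by linarith
  have e1 : √(((e : ℝ) - b) / (((e : ℝ) - s + 1) * ((b : ℝ) - s + 1))) =
      √(((b : ℝ) - s + 1) * ((e : ℝ) - b) / ((e : ℝ) - s + 1)) / ((b : ℝ) - s + 1) := by
    rw [eq_div_iff p1.ne']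
    nth_rewrite 2 [← Real.sqrt_sq p1.le]
    rw [← Real.sqrt_mul (by positivity)]
    congr 1
    field_simp
  have e2 : √(((b : ℝ) - s + 1) / (((e : ℝ) - s + 1) * ((e : ℝ) - b))) =
      √(((b : ℝ) - s + 1) * ((e : ℝ) - b) / ((e : ℝ) - s + 1)) / ((e : ℝ) - b) := by
    rw [eq_div_iff p2.ne']
    nth_rewrite 2 [← Real.sqrt_sq p2.le]
    rw [← Real.sqrt_mul (by positivity)]
    congr 1
    field_simp
  rw [cusum, e1, e2]
  ring

theorem cusum_sq {x : ℕ → ℝ} {s e b : ℕ} (hb : s ≤ b) (he : b < e) :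
    cusum x s e b ^ 2 = (((b : ℝ) - s + 1) * ((e : ℝ) - b) / ((e : ℝ) - s + 1)) *
      ((∑ t ∈ Finset.Icc s b, x t) / ((b : ℝ) - s + 1)
        - (∑ t ∈ Finset.Icc (b + 1) e, x t) / ((e : ℝ) - b)) ^ 2 := by
  have h1 : (s : ℝ) ≤ b := by exact_mod_cast hb
  have h2 : (b : ℝ) < e := by exact_mod_cast he
  rw [cusum_eq hb he, mul_pow, Real.sq_sqrt]
  have p1 : (0 : ℝ) < (b : ℝ) - s + 1 := by linarith
  have p2 : (0 : ℝ) < (e : ℝ) - b := by linarith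
  have p3 : (0 : ℝ) < (e : ℝ) - s + 1 := by linarith
  positivity

theorem cusum_add (x y : ℕ → ℝ) (s e b : ℕ) :
    cusum (fun t => x t + y t) s e b = cusum x s e b + cusum y s e b := by
  simp only [cusum, Finset.sum_add_distrib]
  ring

/-- The CUSUM at the location of the change of a sequence with two constant pieces. -/
theorem cusum_of_step {x : ℕ → ℝ} {s e b : ℕ} (hb : s ≤ b) (he : b < e) {μ ν : ℝ}
    (h1 : ∀ t, s ≤ t → t ≤ b → x t = μ) (h2 : ∀ t, b < t → t ≤ e → x t = ν) :
    cusum x s e b =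
      -√(((b : ℝ) - s + 1) * ((e : ℝ) - b) / ((e : ℝ) - s + 1)) * (ν - μ) := by
  have q1 : (s : ℝ) ≤ b := by exact_mod_cast hb
  have q2 : (b : ℝ) < e := by exact_mod_cast he
  have p1 : (0 : ℝ) < (b : ℝ) - s + 1 := by linarith
  have p2 : (0 : ℝ) < (e : ℝ) - b := by linarith
  rw [cusum_eq hb he, Finset.sum_congr (g := fun _ => μ) rfl,
    Finset.sum_congr (s₁ := Finset.Icc (b + 1) e) (g := fun _ => ν) rfl]
  · have c1 : ((b + 1 - s : ℕ) : ℝ) = (b : ℝ) - s + 1 := by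
      rw [Nat.cast_sub (by omega)]; push_cast; ring
    have c2 : ((e + 1 - (b + 1) : ℕ) : ℝ) = (e : ℝ) - b := by
      rw [Nat.cast_sub (by omega)]; push_cast; ring
    simp only [Finset.sum_const, Nat.card_Icc, nsmul_eq_mul, c1, c2]
    field_simp
    ring
  · intro t ht
    rw [Finset.mem_Icc] at ht
    exact h2 t (by omega) (by omega)
  · intro t ht
    rw [Finset.mem_Icc] at ht
    exact h1 t (by omega) (by omega)

theorem cusum_of_const {x : ℕ → ℝ} {s e b : ℕ} (hb : s ≤ b) (he : b < e) {μ : ℝ}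
    (h : ∀ t, s ≤ t → t ≤ e → x t = μ) : cusum x s e b = 0 := by
  rw [cusum_of_step hb he (fun t h1 h2 => h t h1 (by omega)) (fun t h1 h2 => h t (by omega) h2)]
  simp

/-- Decomposing the variation between three consecutive blocks in two ways. -/
theorem cusum_sq_add_cusum_sq (x : ℕ → ℝ) {s e p q : ℕ} (hp : s ≤ p) (hpq : p < q) (hq : q < e) :
    cusum x s e p ^ 2 + cusum x (p + 1) e q ^ 2 = cusum x s e q ^ 2 + cusum x s q p ^ 2 := by
  have h1 : (s : ℝ) ≤ p := by exact_mod_cast hp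
  have h2 : (p : ℝ) < q := by exact_mod_cast hpq
  have h3 : (q : ℝ) < e := by exact_mod_cast hq
  rw [cusum_sq hp (by omega), cusum_sq (show p + 1 ≤ q by omega) hq,
    cusum_sq (show s ≤ q by omega) hq, cusum_sq hp hpq]
  have dec : ∀ a b c : ℕ, a ≤ b + 1 → b ≤ c → ∑ t ∈ Finset.Icc a c, x t =
      ∑ t ∈ Finset.Icc a b, x t + ∑ t ∈ Finset.Icc (b + 1) c, x t := by
    intro a b c hab hbc
    rw [← Finset.sum_union]
    · congr 1; ext t; simp only [Finset.mem_union, Finset.mem_Icc]; omega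
    · rw [Finset.disjoint_left]; intro t; simp only [Finset.mem_Icc]; omega
  -- In terms of the three block sums A, B, C and block lengths m, n, k, both sides equal the
  -- between-block sum of squares, and the claim is a rational identity.
  rw [dec (p + 1) q e (by omega) (by omega), dec s p q (by omega) (by omega)]
  generalize ∑ t ∈ Finset.Icc s p, x t = A
  generalize ∑ t ∈ Finset.Icc (p + 1) q, x t = B
  generalize ∑ t ∈ Finset.Icc (q + 1) e, x t = C
  push_cast
  obtain ⟨m, hm⟩ : ∃ m, m = (p : ℝ) - s + 1 := ⟨_, rfl⟩
  obtain ⟨n, hn⟩ : ∃ n, n = (q : ℝ) - p := ⟨_, rfl⟩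
  obtain ⟨k, hk⟩ : ∃ k, k = (e : ℝ) - q := ⟨_, rfl⟩
  have e1 : (e : ℝ) - p = n + k := by linarith
  have e2 : (e : ℝ) - s + 1 = m + n + k := by linarith
  have e3 : (q : ℝ) - s + 1 = m + n := by linarith
  have e4 : (q : ℝ) - (p + 1) + 1 = n := by linarith
  have e5 : (e : ℝ) - (p + 1) + 1 = n + k := by linarith
  rw [e1, e2, e3, e4, e5, ← hm, ← hn, ← hk]
  have p1 : 0 < m := by linarith
  have p2 : 0 < n := by linarith
  have p3 : 0 < k := by linarith
  field_simp
  ring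

section

variable {d : ℕ} {G : (Fin d → ℝ) → ℝ}

theorem IsMeanDominant.zero (hG : IsMeanDominant G) : G (fun _ => 0) = 0 := by
  simpa using hG.smul 0 (fun _ => 0)

/-! ### The effect of the noise -/

/-- The CUSUMs of all components of `ε` inside `[1, T]` are bounded by `c`. -/
def CusumBounded (T : ℕ) (ε : ℕ → Fin d → ℝ) (c : ℝ) : Prop :=
  ∀ s b e, 1 ≤ s → s ≤ b → b < e → e ≤ T → ∀ k, |cusum (fun t => ε t k) s e b| ≤ c

/-- The vector of CUSUM statistics. -/
noncomputable def cusumVec (X : ℕ → Fin d → ℝ) (s e b : ℕ) : Fin d → ℝ :=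
  fun k => cusum (fun t => X t k) s e b

theorem IsMeanDominant.absCusum (hG : IsMeanDominant G) (X : ℕ → Fin d → ℝ) (s e b : ℕ) :
    G (absCusum X s e b) = G (cusumVec X s e b) :=
  hG.abs (cusumVec X s e b)

variable {T : ℕ} {f ε : ℕ → Fin d → ℝ} {c : ℝ} {s e b r : ℕ} {μ ν : Fin d → ℝ}

theorem IsMeanDominant.cusumVec_noise_le (hG : IsMeanDominant G) (hc : 0 ≤ c)
    (hε : CusumBounded T ε c) (hs : 1 ≤ s) (hsb : s ≤ b) (hbe : b < e) (heT : e ≤ T) :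
    G (cusumVec ε s e b) ≤ c :=
  hG.le_of_abs_le _ c hc (hε s b e hs hsb hbe heT)

theorem IsMeanDominant.cusumVec_add_le (hG : IsMeanDominant G) (hc : 0 ≤ c)
    (hε : CusumBounded T ε c) (hs : 1 ≤ s) (hsb : s ≤ b) (hbe : b < e) (heT : e ≤ T) :
    G (cusumVec (fun t k => f t k + ε t k) s e b) ≤ G (cusumVec f s e b) + c := by
  have h := hG.add_le (cusumVec f s e b) (cusumVec ε s e b)
  have h2 := hG.cusumVec_noise_le hc hε hs hsb hbe heT
  have h3 : (fun k => cusumVec f s e b k + cusumVec ε s e b k) =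
      cusumVec (fun t k => f t k + ε t k) s e b := by
    ext k; exact (cusum_add _ _ _ _ _).symm
  rw [h3] at h
  linarith

theorem IsMeanDominant.le_cusumVec_add (hG : IsMeanDominant G) (hc : 0 ≤ c)
    (hε : CusumBounded T ε c) (hs : 1 ≤ s) (hsb : s ≤ b) (hbe : b < e) (heT : e ≤ T) :
    G (cusumVec f s e b) ≤ G (cusumVec (fun t k => f t k + ε t k) s e b) + c := by
  have h := hG.add_le (cusumVec (fun t k => f t k + ε t k) s e b)
    (fun k => (-1) * cusumVec ε s e b k)
  rw [hG.smul (-1) (cusumVec ε s e b)] at h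
  have h2 := hG.cusumVec_noise_le hc hε hs hsb hbe heT
  have h3 : (fun k => cusumVec (fun t k => f t k + ε t k) s e b k
      + (-1) * cusumVec ε s e b k) = cusumVec f s e b := by
    ext k
    have := cusum_add (fun t => f t k) (fun t => ε t k) s e b
    simp only [cusumVec]
    linarith
  rw [h3] at h
  simp at h
  linarith

theorem IsMeanDominant.cusumVec_of_const (hG : IsMeanDominant G) (hsb : s ≤ b) (hbe : b < e)
    (h : ∀ t, s ≤ t → t ≤ e → f t = μ) : G (cusumVec f s e b) = 0 := by
  rw [← hG.zero]
  congr 1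
  ext k
  exact cusum_of_const hsb hbe fun t h1 h2 => congrFun (h t h1 h2) k

theorem IsMeanDominant.cusumVec_of_step (hG : IsMeanDominant G) (hsr : s ≤ r) (hre : r < e)
    (h1 : ∀ t, s ≤ t → t ≤ r → f t = μ) (h2 : ∀ t, r < t → t ≤ e → f t = ν) :
    G (cusumVec f s e r) = √(((r : ℝ) - s + 1) * ((e : ℝ) - r) / ((e : ℝ) - s + 1)) *
      G (fun k => ν k - μ k) := by
  have := hG.smul (-√(((r : ℝ) - s + 1) * ((e : ℝ) - r) / ((e : ℝ) - s + 1)))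
    (fun k => ν k - μ k)
  rw [abs_neg, abs_of_nonneg (Real.sqrt_nonneg _)] at this
  rw [← this]
  congr 1
  ext k
  exact cusum_of_step hsr hre (fun t a b => congrFun (h1 t a b) k)
    (fun t a b => congrFun (h2 t a b) k)

/-- In the three-block identity with cuts b and r, one of the four CUSUMs lives on a constant
stretch and vanishes, so the squared CUSUM at r exceeds that at b by a square. -/
theorem IsQuadratic.cusumVec_le_of_step (hG : IsQuadratic G) (hsr : s ≤ r) (hre : r < e)
    (h1 : ∀ t, s ≤ t → t ≤ r → f t = μ) (h2 : ∀ t, r < t → t ≤ e → f t = ν)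
    (hsb : s ≤ b) (hbe : b < e) : G (cusumVec f s e b) ≤ G (cusumVec f s e r) := by
  rcases lt_trichotomy b r with h | h | h
  · refine hG.le_of_sq_add_sq (cusumVec f (b + 1) e r) (fun _ => 0) _ _ (fun k => ?_)
      (by rw [hG.zero]; exact hG.nonneg _)
    have := cusum_sq_add_cusum_sq (fun t => f t k) hsb h hre
    rw [cusum_of_const (s := s) (e := r) hsb h fun t a b => congrFun (h1 t a b) k] at this
    simp only [cusumVec]
    linarith
  · rw [h]
  · refine hG.le_of_sq_add_sq (cusumVec f s b r) (fun _ => 0) _ _ (fun k => ?_)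
      (by rw [hG.zero]; exact hG.nonneg _)
    have := cusum_sq_add_cusum_sq (fun t => f t k) hsr h hbe
    rw [cusum_of_const (s := r + 1) (e := e) h hbe
      fun t a b => congrFun (h2 t (by omega) b) k] at this
    simp only [cusumVec]
    linarith

/-! ### Elementary inequalities behind the localisation bound. -/

theorem min_div_two_le_mul_div_add {x y : ℝ} (hx : 0 < x) (hy : 0 < y) :
    min x y / 2 ≤ x * y / (x + y) := by
  rw [div_le_div_iff₀ two_pos (by positivity)]
  rcases le_total x y with h | h
  · rw [min_eq_left h]; nlinarith
  · rw [min_eq_right h]; nlinarith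

/-- Squaring bounds min(x, y) g² by 8c². The minimum cannot be y, as 81c² ≤ y g², except when c = 0;
then g = 0 and the bound is trivial. -/
theorem mul_sq_le_of_min_le {x y g c : ℝ} (hx : 0 < x) (hy : 0 < y)
    (h : √(x * y / (x + y)) * g ≤ 2 * c) (hg : 0 ≤ g) (hyg : 81 * c ^ 2 ≤ y * g ^ 2) :
    x * g ^ 2 ≤ 8 * c ^ 2 := by
  have h0 : 0 ≤ x * y / (x + y) := by positivity
  have h1 : x * y / (x + y) * g ^ 2 ≤ 4 * c ^ 2 := by
    have h4 := pow_le_pow_left₀ (mul_nonneg (Real.sqrt_nonneg _) hg) h 2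
    rw [mul_pow, Real.sq_sqrt h0] at h4
    linarith
  have h2 := mul_le_mul_of_nonneg_right (min_div_two_le_mul_div_add hx hy) (sq_nonneg g)
  rcases le_total x y with h3 | h3
  · rw [min_eq_left h3] at h2; linarith
  · rw [min_eq_right h3] at h2
    have h5 : c ^ 2 ≤ 0 := by linarith [sq_nonneg c]
    have h6 : y * g ^ 2 ≤ 0 := by linarith
    have h7 : g ^ 2 ≤ 0 := by
      by_contra! h8
      exact absurd h6 (not_le.2 (mul_pos hy h8))
    have h8 := mul_nonneg hx.le (sub_nonneg.2 h7)
    nlinarith [sq_nonneg c]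

/-- Since xy/(x+y) is at most x and at most y, a large CUSUM leaves no side of the change short; 81
= (10 - 1)² comes from a threshold of 10c reduced by one noise term. -/
theorem sq_le_mul_sq_of_lt_sqrt_mul {x y g c z : ℝ} (hx : 0 < x) (hy : 0 < y)
    (hc : 0 ≤ c) (hz : 10 * c ≤ z) (h : z - c ≤ √(x * y / (x + y)) * g) :
    81 * c ^ 2 ≤ x * g ^ 2 ∧ 81 * c ^ 2 ≤ y * g ^ 2 := by
  have h1 : 9 * c ≤ √(x * y / (x + y)) * g := by linarith
  have h2 := pow_le_pow_left₀ (by positivity) h1 2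
  rw [mul_pow, mul_pow, Real.sq_sqrt (by positivity)] at h2
  have h3 : x * y / (x + y) ≤ x := by
    rw [div_le_iff₀ (by positivity)]; nlinarith
  have h4 : x * y / (x + y) ≤ y := by
    rw [div_le_iff₀ (by positivity)]; nlinarith
  have h5 := mul_le_mul_of_nonneg_right h3 (sq_nonneg g)
  have h6 := mul_le_mul_of_nonneg_right h4 (sq_nonneg g)
  constructor <;> nlinarith

/-- The distance between the only change in an interval and a location whose CUSUM is large and
not smaller than that at the change. -/
theorem IsQuadratic.dist_mul_sq_le (hG : IsQuadratic G) (hc : 0 ≤ c)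
    (hε : CusumBounded T ε c) (hs : 1 ≤ s) (heT : e ≤ T) (hsr : s ≤ r) (hre : r < e)
    (h1 : ∀ t, s ≤ t → t ≤ r → f t = μ) (h2 : ∀ t, r < t → t ≤ e → f t = ν)
    (hsb : s ≤ b) (hbe : b < e) {ζ : ℝ} (hζ : 10 * c ≤ ζ)
    (hb : ζ < G (cusumVec (fun t k => f t k + ε t k) s e b))
    (hmax : G (cusumVec (fun t k => f t k + ε t k) s e r) ≤
      G (cusumVec (fun t k => f t k + ε t k) s e b)) :
    |(b : ℝ) - r| * G (fun k => ν k - μ k) ^ 2 ≤ 8 * c ^ 2 := by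
  have q1 : (s : ℝ) ≤ r := by exact_mod_cast hsr
  have q2 : (r : ℝ) < e := by exact_mod_cast hre
  have q3 : (s : ℝ) ≤ b := by exact_mod_cast hsb
  have q4 : (b : ℝ) < e := by exact_mod_cast hbe
  have p1 : (0 : ℝ) < (r : ℝ) - s + 1 := by linarith
  have p2 : (0 : ℝ) < (e : ℝ) - r := by linarith
  have hG0 := hG.nonneg (fun k => ν k - μ k)
  -- The signal CUSUM is largest at the change, so exceeding ζ at b, after paying c for the noise,
  -- bounds the signal CUSUM at r from below.
  have hlarge : ζ - c ≤ √(((r : ℝ) - s + 1) * ((e : ℝ) - r) /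
      (((r : ℝ) - s + 1) + ((e : ℝ) - r))) * G (fun k => ν k - μ k) := by
    have i1 := hG.cusumVec_add_le (f := f) hc hε hs hsb hbe heT
    have i2 := hG.cusumVec_le_of_step hsr hre h1 h2 hsb hbe
    rw [hG.cusumVec_of_step hsr hre h1 h2] at i2
    rw [show ((r : ℝ) - s + 1) + ((e : ℝ) - r) = (e : ℝ) - s + 1 by ring]
    linarith
  obtain ⟨l1, l2⟩ := sq_le_mul_sq_of_lt_sqrt_mul p1 p2 hc hζ hlarge
  rcases lt_trichotomy b r with h | h | h
  · have q5 : (b : ℝ) < r := by exact_mod_cast h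
    have w := hG.le_of_sq_add_sq _ _ (cusumVec (fun t k => f t k + ε t k) s r b)
      (cusumVec (fun t k => f t k + ε t k) (b + 1) e r)
      (fun k => cusum_sq_add_cusum_sq (fun t => f t k + ε t k) hsb h hre) hmax
    have v := hG.cusumVec_add_le (f := f) hc hε hs hsb h (by omega)
    rw [hG.cusumVec_of_const hsb h h1] at v
    have w2 := hG.le_cusumVec_add (f := f) (s := b + 1) (b := r) (e := e) hc hε
      (by omega) h hre heT
    rw [hG.cusumVec_of_step (s := b + 1) h hre (fun t a b => h1 t (by omega) b) h2] at w2
    push_cast at w2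
    rw [abs_of_neg (by linarith)]
    refine (mul_sq_le_of_min_le (x := -((b : ℝ) - r)) (y := (e : ℝ) - r)
      (by linarith) p2 ?_ hG0 l2)
    rw [show (r : ℝ) - (b + 1) + 1 = -((b : ℝ) - r) by ring,
      show (e : ℝ) - (b + 1) + 1 = -((b : ℝ) - r) + ((e : ℝ) - r) by ring] at w2
    linarith
  · subst h
    simp only [sub_self, abs_zero, zero_mul]
    positivity
  -- The mirror case: the jump now sits in [s,b], the pure noise in [r+1,e], and the identity is
  -- read from right to left.
  · have q5 : (r : ℝ) < b := by exact_mod_cast h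
    have w := hG.le_of_sq_add_sq (cusumVec (fun t k => f t k + ε t k) s e b)
      (cusumVec (fun t k => f t k + ε t k) s e r)
      (cusumVec (fun t k => f t k + ε t k) (r + 1) e b)
      (cusumVec (fun t k => f t k + ε t k) s b r)
      (fun k => (cusum_sq_add_cusum_sq (fun t => f t k + ε t k) hsr h hbe).symm) hmax
    have v := hG.cusumVec_add_le (f := f) (s := r + 1) (b := b) (e := e) hc hε
      (by omega) h hbe heT
    rw [hG.cusumVec_of_const (s := r + 1) h hbe fun t a b => h2 t (by omega) b] at v
    have w2 := hG.le_cusumVec_add (f := f) (e := b) hc hε hs hsr h (by omega)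
    rw [hG.cusumVec_of_step hsr h h1 fun t a b => h2 t a (by omega)] at w2
    rw [abs_of_pos (by linarith)]
    refine (mul_sq_le_of_min_le (x := (b : ℝ) - r) (y := (r : ℝ) - s + 1)
      (by linarith) p1 ?_ hG0 l1)
    rw [show ((r : ℝ) - s + 1) * ((b : ℝ) - r) = ((b : ℝ) - r) * ((r : ℝ) - s + 1) by ring,
      show (b : ℝ) - s + 1 = (b : ℝ) - r + ((r : ℝ) - s + 1) by ring] at w2
    linarith

/-- A change that is far from both end-points of the interval makes the contrast large. -/
theorem IsMeanDominant.lt_cusumVec_of_step (hG : IsMeanDominant G) (hc : 0 ≤ c)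
    (hε : CusumBounded T ε c) (hs : 1 ≤ s) (heT : e ≤ T) (hsr : s ≤ r) (hre : r < e)
    (h1 : ∀ t, s ≤ t → t ≤ r → f t = μ) (h2 : ∀ t, r < t → t ≤ e → f t = ν)
    {w ζ : ℝ} (hl : w ≤ (r : ℝ) - s + 1) (hr : w ≤ (e : ℝ) - r)
    (hζ : ζ + c < √(w / 2) * G (fun k => ν k - μ k)) :
    ζ < G (cusumVec (fun t k => f t k + ε t k) s e r) := by
  have q1 : (s : ℝ) ≤ r := by exact_mod_cast hsr
  have q2 : (r : ℝ) < e := by exact_mod_cast hre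
  have i1 := hG.le_cusumVec_add (f := f) hc hε hs hsr hre heT
  rw [hG.cusumVec_of_step hsr hre h1 h2] at i1
  have i2 : √(w / 2) ≤ √(((r : ℝ) - s + 1) * ((e : ℝ) - r) / ((e : ℝ) - s + 1)) := by
    apply Real.sqrt_le_sqrt
    have := min_div_two_le_mul_div_add (x := (r : ℝ) - s + 1) (y := (e : ℝ) - r)
      (by linarith) (by linarith)
    rw [show ((r : ℝ) - s + 1) + ((e : ℝ) - r) = (e : ℝ) - s + 1 by ring] at this
    have := le_min hl hr
    linarith
  have i3 := mul_le_mul_of_nonneg_right i2 (hG.nonneg (fun k => ν k - μ k))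
  linarith

/-! ### Piecewise-constant signals -/

variable {N : ℕ} {τ : ℕ → ℕ}

theorem IsPiecewiseConstant.eq_of_no_change (hf : IsPiecewiseConstant T N τ f) (hs : 1 ≤ s)
    (heT : e ≤ T) (h : ∀ j, 1 ≤ j → j ≤ N → s ≤ τ j → e ≤ τ j) :
    ∀ t, s ≤ t → t ≤ e → f t = f s := by
  intro t hst
  induction t, hst using Nat.le_induction with
  | base => intro _; rfl
  | succ t hst ih =>
    intro hte
    rw [← ih (by omega)]
    -- The least such j indexes the constant piece containing t. The value can only move at t + 1 if
    -- t = τ (j + 1), which is excluded by the hypothesis for j < N and by τ (N + 1) = T for j = N.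
    have hex : ∃ j, t ≤ τ (j + 1) := ⟨N, by rw [hf.r_last]; omega⟩
    classical
    have hj := Nat.find_spec hex
    have hjN : Nat.find hex ≤ N := Nat.find_min' hex (by rw [hf.r_last]; omega)
    have hlt : τ (Nat.find hex) < t := by
      rcases Nat.eq_zero_or_pos (Nat.find hex) with h0 | h0
      · rw [h0, hf.r_zero]; omega
      · have := Nat.find_min hex (m := Nat.find hex - 1) (by omega)
        rw [Nat.sub_add_cancel h0] at this
        omega
    generalize Nat.find hex = j at *
    have hne : t + 1 ≤ τ (j + 1) := by
      rcases hjN.eq_or_lt with h0 | h0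
      · rw [h0, hf.r_last]; omega
      · have := h (j + 1) (by omega) (by omega) (by omega)
        omega
    obtain ⟨μ, hμ⟩ := hf.const j hjN
    rw [hμ t hlt hj, hμ (t + 1) (by omega) hne]

theorem IsPiecewiseConstant.add_minGap_le (hf : IsPiecewiseConstant T N τ f) {j : ℕ}
    (hj : j ≤ N) : τ j + minGap N τ ≤ τ (j + 1) := by
  have h1 : minGap N τ ≤ gap τ j := Finset.inf'_le _ (by simp; omega)
  have h2 := hf.r_lt j hj
  unfold gap at h1
  omega

theorem IsPiecewiseConstant.add_minGap_le_of_lt (hf : IsPiecewiseConstant T N τ f) {i j : ℕ}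
    (hij : i < j) (hj : j ≤ N + 1) : τ i + minGap N τ ≤ τ j := by
  induction j, hij using Nat.le_induction with
  | base => exact hf.add_minGap_le (by omega)
  | succ j hij ih =>
    have := ih (by omega)
    have := hf.r_lt j (by omega)
    omega

theorem IsPiecewiseConstant.minGap_pos (hf : IsPiecewiseConstant T N τ f) : 0 < minGap N τ := by
  rw [minGap, Finset.lt_inf'_iff]
  intro j hj
  have := hf.r_lt j (by simp at hj; omega)
  unfold gap
  omega

theorem IsPiecewiseConstant.lt_of_lt (hf : IsPiecewiseConstant T N τ f) {i j : ℕ}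
    (hij : i < j) (hj : j ≤ N + 1) : τ i < τ j := by
  have := hf.add_minGap_le_of_lt hij hj
  have := hf.minGap_pos
  omega

end

section

/-! ### The search intervals -/

theorem leftPt_anti (lam s p : ℕ) {m m' : ℕ} (h : m ≤ m') :
    leftPt lam s p m' ≤ leftPt lam s p m := by
  have := Nat.mul_le_mul_right lam h
  unfold leftPt
  omega

theorem rightPt_mono (lam e p : ℕ) {m m' : ℕ} (h : m ≤ m') :
    rightPt lam e p m ≤ rightPt lam e p m' := by
  have := Nat.mul_le_mul_right lam h
  unfold rightPt
  omega

theorem leftPt_eq_of_le {lam s p m : ℕ} (hlam : 1 ≤ lam) (hm : numLeft lam s p ≤ m) :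
    leftPt lam s p m = s := by
  have h1 := Nat.ceil_le.1 hm
  rw [div_le_iff₀ (by exact_mod_cast hlam)] at h1
  have h2 : p + 1 ≤ m * lam + s := by
    have : (p : ℝ) + 1 ≤ m * lam + s := by linarith
    exact_mod_cast this
  unfold leftPt
  omega

theorem rightPt_eq_of_le {lam e p m : ℕ} (hlam : 1 ≤ lam) (hm : numRight lam e p ≤ m) :
    rightPt lam e p m = e := by
  have h1 := Nat.ceil_le.1 hm
  rw [div_le_iff₀ (by exact_mod_cast hlam)] at h1
  have h2 : e + 1 ≤ m * lam + p := by
    have : (e : ℝ) + 1 ≤ m * lam + p := by linarith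
    exact_mod_cast this
  unfold rightPt
  omega

/-- The search intervals are nested. -/
theorem searchInterval_mono (lam s e p : ℕ) {i j : ℕ} (h : i ≤ j) :
    (searchInterval lam s e p j).1 ≤ (searchInterval lam s e p i).1 ∧
      (searchInterval lam s e p i).2 ≤ (searchInterval lam s e p j).2 := by
  unfold searchInterval
  dsimp only
  split_ifs <;> exact ⟨leftPt_anti _ _ _ (by omega), rightPt_mono _ _ _ (by omega)⟩

theorem numLeft_pos {lam s p : ℕ} (hlam : 1 ≤ lam) (hsp : s ≤ p) : 0 < numLeft lam s p := by
  have : (s : ℝ) ≤ p := by exact_mod_cast hsp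
  have h2 : (0 : ℝ) < lam := by exact_mod_cast hlam
  exact Nat.ceil_pos.2 (div_pos (by linarith) h2)

theorem numRight_pos {lam e p : ℕ} (hlam : 1 ≤ lam) (hpe : p ≤ e) : 0 < numRight lam e p := by
  have : (p : ℝ) ≤ e := by exact_mod_cast hpe
  have h2 : (0 : ℝ) < lam := by exact_mod_cast hlam
  exact Nat.ceil_pos.2 (div_pos (by linarith) h2)

/-- Every symmetric expansion of the starting point is one of the search intervals. -/
theorem exists_searchInterval_eq {lam s e p m : ℕ} (hlam : 1 ≤ lam) (hsp : s ≤ p) (hpe : p ≤ e)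
    (hm : 1 ≤ m) : ∃ j, 1 ≤ j ∧ j ≤ numLeft lam s p + numRight lam e p ∧
      searchInterval lam s e p j = (leftPt lam s p m, rightPt lam e p m) := by
  have hl := numLeft_pos hlam hsp
  have hr := numRight_pos hlam hpe
  by_cases h1 : m ≤ min (numLeft lam s p) (numRight lam e p)
  · refine ⟨2 * m, by omega, by omega, ?_⟩
    unfold searchInterval
    rw [if_pos (by omega)]
    congr 2 <;> omega
  by_cases h2 : m ≤ max (numLeft lam s p) (numRight lam e p)
  · refine ⟨m + min (numLeft lam s p) (numRight lam e p), by omega, by omega, ?_⟩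
    unfold searchInterval
    rw [if_neg (by omega)]
    congr 2 <;> omega
  -- Beyond both step counts the expansion is all of [s,e], which is the last interval of the
  -- search.
  · refine ⟨numLeft lam s p + numRight lam e p, by omega, le_rfl, ?_⟩
    unfold searchInterval
    rw [leftPt_eq_of_le hlam (m := m) (by omega), rightPt_eq_of_le hlam (m := m) (by omega)]
    dsimp only
    split_ifs <;>
      rw [leftPt_eq_of_le hlam (by omega), rightPt_eq_of_le hlam (by omega)]

theorem find?_map_range'_eq_none {α : Type*} (P : α → Bool) (g : ℕ → α) (n : ℕ)
    (h : ∀ j, 1 ≤ j → j ≤ n → P (g j) = false) :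
    ((List.range' 1 n).map g).find? P = none := by
  rw [List.find?_eq_none]
  intro x hx
  obtain ⟨j, hj, rfl⟩ := List.mem_map.1 hx
  rw [List.mem_range'_1] at hj
  simp [h j hj.1 (by omega)]

/-- The index bound j ≤ j₀ is what matters: with nested search intervals it places the first hit
inside any interval known to be a hit. -/
theorem find?_map_range'_eq_some {α : Type*} (P : α → Bool) (g : ℕ → α) (n j₀ : ℕ)
    (h1 : 1 ≤ j₀) (h2 : j₀ ≤ n) (h : P (g j₀) = true) :
    ∃ j, 1 ≤ j ∧ j ≤ j₀ ∧ P (g j) = true ∧ ((List.range' 1 n).map g).find? P = some (g j) := by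
  classical
  have hex : ∃ j, 1 ≤ j ∧ P (g j) = true := ⟨j₀, h1, h⟩
  obtain ⟨f1, f2⟩ := Nat.find_spec hex
  have f3 : Nat.find hex ≤ j₀ := Nat.find_min' hex ⟨h1, h⟩
  have f4 : ∀ i, 1 ≤ i → i < Nat.find hex → P (g i) = false := by
    intro i hi hlt
    have := Nat.find_min hex hlt
    simpa [hi] using this
  refine ⟨Nat.find hex, f1, f3, f2, ?_⟩
  generalize Nat.find hex = j at *
  have : List.range' 1 n = List.range' 1 (j - 1) ++ List.range' j (n + 1 - j) := by
    have := List.range'_append_1 (s := 1) (m := j - 1) (n := n + 1 - j)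
    rw [show 1 + (j - 1) = j by omega, show j - 1 + (n + 1 - j) = n by omega] at this
    exact this.symm
  rw [this, List.map_append, List.find?_append, find?_map_range'_eq_none P g (j - 1)
    (fun i a b => f4 i a (by omega)), show n + 1 - j = (n - j) + 1 by omega, List.range'_succ]
  simp [f2]

/-- The expansion of the starting point `p` which isolates the change `x` when all other changes
`y` are farther away from `p`. -/
theorem exists_isolating_expansion {lam s e p x : ℕ} {u : ℝ} (hlam : 1 ≤ lam) (hu : (lam : ℝ) ≤ u)
    (hl : u / 2 ≤ (x : ℝ) - s + 1) (hr : u / 2 ≤ (e : ℝ) - x) :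
    ∃ m, 1 ≤ m ∧ u / 2 ≤ (x : ℝ) - leftPt lam s p m + 1 ∧
      u / 2 ≤ (rightPt lam e p m : ℝ) - x ∧
      ∀ y : ℕ, |(p : ℝ) - x| + 3 * u ≤ |(p : ℝ) - y| →
        (y : ℝ) + u / 2 ≤ leftPt lam s p m ∨ (rightPt lam e p m : ℝ) + u / 2 ≤ y := by
  have hlam' : (1 : ℝ) ≤ lam := by exact_mod_cast hlam
  have hD := abs_nonneg ((p : ℝ) - x)
  have hD1 : (p : ℝ) - x ≤ |(p : ℝ) - x| := le_abs_self _
  have hD2 : (x : ℝ) - p ≤ |(p : ℝ) - x| := by rw [abs_sub_comm]; exact le_abs_self _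
  generalize |(p : ℝ) - x| = D at *
  -- The least radius m·lam reaching D + u/2 + 1; the extra 1 pays for the -1 in the right
  -- end-point. Rounding up costs at most lam ≤ u, so the radius is below D + 3u/2 + 1, and a
  -- further u/2 still fits in D + 3u because 1 ≤ lam ≤ u.
  obtain ⟨m, hm⟩ : ∃ m, m = ⌈(D + u / 2 + 1) / lam⌉₊ := ⟨_, rfl⟩
  have hpos : (0 : ℝ) ≤ (D + u / 2 + 1) / lam := by
    have : 0 ≤ u := by linarith
    positivity
  have m1 : D + u / 2 + 1 ≤ m * lam := by
    rw [← div_le_iff₀ (by linarith), hm]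
    exact Nat.le_ceil _
  have m2 : (m : ℝ) * lam < D + u / 2 + 1 + lam := by
    have h := Nat.ceil_lt_add_one hpos
    rw [← hm] at h
    have h2 := mul_lt_mul_of_pos_right h (show (0 : ℝ) < lam by linarith)
    rwa [add_mul, div_mul_cancel₀ _ (by linarith), one_mul] at h2
  have hm1 : 1 ≤ m := by
    by_contra! h
    have h0 : m = 0 := by omega
    rw [h0] at m1
    push_cast at m1
    linarith
  -- This makes the truncated subtraction in the right end-point exact.
  have hml : 1 ≤ m * lam := Nat.mul_pos hm1 hlam
  have eL : leftPt lam s p m = s ∨ (leftPt lam s p m : ℝ) = p - m * lam := by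
    by_cases h : p - m * lam ≤ s
    · left; unfold leftPt; omega
    · right
      have : leftPt lam s p m + m * lam = p := by unfold leftPt; omega
      have : ((leftPt lam s p m : ℝ)) + m * lam = p := by exact_mod_cast this
      linarith
  have gL : (p : ℝ) - m * lam ≤ leftPt lam s p m := by
    have : p ≤ leftPt lam s p m + m * lam := by unfold leftPt; omega
    have : (p : ℝ) ≤ leftPt lam s p m + m * lam := by exact_mod_cast this
    linarith
  have eR : rightPt lam e p m = e ∨ (rightPt lam e p m : ℝ) = p + m * lam - 1 := by
    by_cases h : e ≤ p + m * lam - 1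
    · left; unfold rightPt; omega
    · right
      have : rightPt lam e p m + 1 = p + m * lam := by unfold rightPt; omega
      have : ((rightPt lam e p m : ℝ)) + 1 = p + m * lam := by exact_mod_cast this
      linarith
  have gR : (rightPt lam e p m : ℝ) ≤ p + m * lam - 1 := by
    have : rightPt lam e p m + 1 ≤ p + m * lam := by unfold rightPt; omega
    have : (rightPt lam e p m : ℝ) + 1 ≤ p + m * lam := by exact_mod_cast this
    linarith
  refine ⟨m, hm1, ?_, ?_, fun y hy => ?_⟩
  -- If the expansion is clipped at s, the depth is the assumed depth of x in [s,e].
  · rcases eL with h | h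
    · rw [h]; exact hl
    · rw [h]; linarith
  · rcases eR with h | h
    · rw [h]; exact hr
    · rw [h]; linarith
  · rcases le_total (p : ℝ) y with h | h
    · right
      rw [abs_of_nonpos (by linarith)] at hy
      linarith
    · left
      rw [abs_of_nonneg (by linarith)] at hy
      linarith

/-! ### The change closest to the starting point -/

variable {d T N : ℕ} {τ : ℕ → ℕ} {f : ℕ → Fin d → ℝ}

theorem IsPiecewiseConstant.le_of_le (hf : IsPiecewiseConstant T N τ f) {i j : ℕ}
    (hij : i ≤ j) (hj : j ≤ N + 1) : τ i ≤ τ j := by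
  rcases hij.eq_or_lt with h | h
  · rw [h]
  · exact (hf.lt_of_lt h hj).le

theorem cast_gap (hf : IsPiecewiseConstant T N τ f) {j : ℕ} (hj : j ≤ N) :
    (gap τ j : ℝ) = τ (j + 1) - τ j :=
  Nat.cast_sub (hf.r_lt j hj).le

/-- An admissible starting point is not close to the midpoint between two changes. -/
theorem AdmissibleStart.le_or_le {n : ℝ} {p a : ℕ} (h : AdmissibleStart n T N τ p)
    (hf : IsPiecewiseConstant T N τ f) (ha : 1 ≤ a) (haN : a + 1 ≤ N) :
    (p : ℝ) - τ a + 2 * (3 * (minGap N τ : ℝ) / (4 * n)) ≤ τ (a + 1) - p ∨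
      (τ (a + 1) : ℝ) - p + 2 * (3 * (minGap N τ : ℝ) / (4 * n)) ≤ p - τ a := by
  unfold AdmissibleStart at h
  dsimp only at h
  generalize 3 * (minGap N τ : ℝ) / (4 * n) = c at *
  -- Midpoints between consecutive changes increase with the index, so lying c below one midpoint
  -- means lying c below every later one; `high` is the mirror image.
  have low : ∀ k, k ≤ a → (p : ℝ) ≤ τ k + (gap τ k : ℝ) / 2 - c →
      (p : ℝ) - τ a + 2 * c ≤ τ (a + 1) - p := by
    intro k hk hp
    rw [cast_gap hf (by omega)] at hp
    have h1 : (τ k : ℝ) ≤ τ a := by exact_mod_cast hf.le_of_le hk (by omega)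
    have h2 : (τ (k + 1) : ℝ) ≤ τ (a + 1) := by exact_mod_cast hf.le_of_le (by omega) (by omega)
    linarith
  have high : ∀ k, a + 1 ≤ k → k ≤ N → (τ k : ℝ) - (gap τ (k - 1) : ℝ) / 2 + c ≤ p →
      (τ (a + 1) : ℝ) - p + 2 * c ≤ p - τ a := by
    intro k hk hkN hp
    rw [cast_gap hf (by omega), Nat.sub_add_cancel (by omega)] at hp
    have h1 : (τ a : ℝ) ≤ τ (k - 1) := by exact_mod_cast hf.le_of_le (by omega) (by omega)
    have h2 : (τ (a + 1) : ℝ) ≤ τ k := by exact_mod_cast hf.le_of_le (by omega) (by omega)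
    linarith
  rcases h with ⟨-, h⟩ | ⟨h, -⟩ | ⟨k, hk1, hk2, h1, h2⟩
  · exact Or.inl (low 1 ha h)
  · exact Or.inr (high N haN le_rfl h)
  · rcases le_or_gt k a with hk | hk
    · exact Or.inl (low k hk h2)
    · exact Or.inr (high k hk (by omega) h1)

/-- If the starting point is admissible, one of the changes visible in `[s, e]` is closer to it
than all the others, by a margin. -/
theorem exists_closest_change {n : ℝ} (hn : 3 / 2 ≤ n) (hf : IsPiecewiseConstant T N τ f)
    {s e p : ℕ} (hp : AdmissibleStart n T N τ p)
    (hex : ∃ j, 1 ≤ j ∧ j ≤ N ∧ s ≤ τ j ∧ τ j < e) :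
    ∃ j, (1 ≤ j ∧ j ≤ N ∧ s ≤ τ j ∧ τ j < e) ∧
      ∀ i, 1 ≤ i → i ≤ N → s ≤ τ i → τ i < e → i ≠ j →
        |(p : ℝ) - τ j| + 3 * ((minGap N τ : ℝ) / (2 * n)) ≤ |(p : ℝ) - τ i| := by
  classical
  obtain ⟨j₀, a1, a2, a3, a4⟩ := hex
  have hδ : (0 : ℝ) < minGap N τ := by exact_mod_cast hf.minGap_pos
  -- This is where n ≥ 3/2 is used: the margin 3u is at most the minimal gap, so only two adjacent
  -- changes on opposite sides of p need admissibility.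
  have hu : 3 * ((minGap N τ : ℝ) / (2 * n)) ≤ minGap N τ := by
    rw [← mul_div_assoc, div_le_iff₀ (by linarith)]
    nlinarith
  have hu0 : 0 < (minGap N τ : ℝ) / (2 * n) := by
    have : 0 < n := by linarith
    positivity
  have hc : 2 * (3 * (minGap N τ : ℝ) / (4 * n)) = 3 * ((minGap N τ : ℝ) / (2 * n)) := by
    have : n ≠ 0 := by linarith
    field_simp
    ring
  obtain ⟨j, hj, hmin⟩ := ((Finset.Icc 1 N).filter fun j => s ≤ τ j ∧ τ j < e).exists_min_image
    (fun j => |(p : ℝ) - τ j|) ⟨j₀, by simp; omega⟩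
  simp only [Finset.mem_filter, Finset.mem_Icc] at hj hmin
  obtain ⟨⟨j1, j2⟩, j3, j4⟩ := hj
  have sep : ∀ a b, a < b → b ≤ N → (τ a : ℝ) + minGap N τ ≤ τ b := by
    intro a b hab hb
    exact_mod_cast hf.add_minGap_le_of_lt hab (by omega)
  refine ⟨j, ⟨j1, j2, j3, j4⟩, fun i i1 i2 i3 i4 hij => ?_⟩
  have hi := hmin i ⟨⟨i1, i2⟩, i3, i4⟩
  rcases le_total (p : ℝ) (τ j) with pj | pj <;> rcases le_total (p : ℝ) (τ i) with pi | pi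
  · rw [abs_of_nonpos (a := (p : ℝ) - τ j) (by linarith),
      abs_of_nonpos (a := (p : ℝ) - τ i) (by linarith)] at hi ⊢
    rcases lt_or_gt_of_ne hij with h | h
    · have := sep i j h j2; linarith
    · have := sep j i h i2; linarith
  · have hlt : i < j := by
      by_contra! h
      have := sep j i (by omega) i2
      linarith
    rw [abs_of_nonpos (a := (p : ℝ) - τ j) (by linarith),
      abs_of_nonneg (a := (p : ℝ) - τ i) (by linarith)] at hi ⊢
    by_cases h : j = i + 1
    -- Adjacent changes: admissibility keeps p at distance 3u/2 from their midpoint. Otherwise the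
    -- change next to i lies in between, is also visible, and cannot beat j, which yields a full
    -- gap.
    · subst h
      have := hp.le_or_le hf i1 j2
      rw [hc] at this
      rcases this with h | h <;> linarith
    · have q1 := sep i (i + 1) (by omega) (by omega)
      have q2 := sep (i + 1) j (by omega) j2
      have q3 := hf.lt_of_lt (i := i) (j := i + 1) (by omega) (by omega)
      have q4 := hf.lt_of_lt (i := i + 1) (j := j) (by omega) (by omega)
      have hi' := hmin (i + 1) ⟨⟨by omega, by omega⟩, by omega, by omega⟩
      rw [abs_of_nonpos (a := (p : ℝ) - τ j) (by linarith)] at hi'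
      rcases le_total (p : ℝ) (τ (i + 1)) with h' | h'
      · rw [abs_of_nonpos (by linarith)] at hi'
        linarith
      · rw [abs_of_nonneg (by linarith)] at hi'
        linarith
  · have hlt : j < i := by
      by_contra! h
      have := sep i j (by omega) j2
      linarith
    rw [abs_of_nonneg (a := (p : ℝ) - τ j) (by linarith),
      abs_of_nonpos (a := (p : ℝ) - τ i) (by linarith)] at hi ⊢
    by_cases h : i = j + 1
    · subst h
      have := hp.le_or_le hf j1 i2
      rw [hc] at this
      rcases this with h | h <;> linarith
    · have q1 := sep (i - 1) i (by omega) i2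
      have q2 := sep j (i - 1) (by omega) (by omega)
      have q3 := hf.lt_of_lt (i := j) (j := i - 1) (by omega) (by omega)
      have q4 := hf.lt_of_lt (i := i - 1) (j := i) (by omega) (by omega)
      have hi' := hmin (i - 1) ⟨⟨by omega, by omega⟩, by omega, by omega⟩
      rw [abs_of_nonneg (a := (p : ℝ) - τ j) (by linarith)] at hi'
      rcases le_total (p : ℝ) (τ (i - 1)) with h' | h'
      · rw [abs_of_nonpos (by linarith)] at hi'
        linarith
      · rw [abs_of_nonneg (by linarith)] at hi'
        linarith
  · rw [abs_of_nonneg (a := (p : ℝ) - τ j) (by linarith),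
      abs_of_nonneg (a := (p : ℝ) - τ i) (by linarith)] at hi ⊢
    rcases lt_or_gt_of_ne hij with h | h
    · have := sep i j h j2; linarith
    · have := sep j i h i2; linarith

end

section

/-! ### Detection of isolated changes -/

variable {d : ℕ}

/-- The deterministic conditions under which MDAIS recovers the changes `τ` of the signal `f`
from the observations `f + ε`. -/
structure DetectionRegime (n : ℝ) (L : AggNorm) (f ε : ℕ → Fin d → ℝ) (T N : ℕ) (τ : ℕ → ℕ)
    (lam : ℕ) (ζ c : ℝ) : Prop where
  three_halves_le : 3 / 2 ≤ n
  signal : IsPiecewiseConstant T N τ f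
  noise_nonneg : 0 ≤ c
  noise : CusumBounded T ε c
  lam_pos : 1 ≤ lam
  lam_le : (lam : ℝ) ≤ (minGap N τ : ℝ) / (2 * n)
  le_threshold : 10 * c ≤ ζ
  threshold_lt : ∀ j, 1 ≤ j → j ≤ N →
    ζ + c < √((minGap N τ : ℝ) / (2 * n) / 2 / 2) * L.eval (jumpVec f τ j)

variable {n : ℝ} {L : AggNorm} {f ε : ℕ → Fin d → ℝ} {T N : ℕ} {τ : ℕ → ℕ} {lam : ℕ} {ζ c : ℝ}

theorem contrast_eq (X : ℕ → Fin d → ℝ) (s e b : ℕ) :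
    contrast L X s e b = L.eval (cusumVec X s e b) :=
  (isMeanDominant_eval L).absCusum X s e b

theorem IsMeanDominant.jumpVec {G : (Fin d → ℝ) → ℝ} (hG : IsMeanDominant G) (j : ℕ) :
    G (jumpVec f τ j) = G (fun k => f (τ j + 1) k - f (τ j) k) :=
  hG.abs (fun k => f (τ j + 1) k - f (τ j) k)

theorem DetectionRegime.contrast_le_of_no_change (h : DetectionRegime n L f ε T N τ lam ζ c)
    {l r b : ℕ} (hl : 1 ≤ l) (hr : r ≤ T) (hlb : l ≤ b) (hbr : b < r)
    (hno : ∀ j, 1 ≤ j → j ≤ N → l ≤ τ j → r ≤ τ j) :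
    contrast L (fun t k => f t k + ε t k) l r b ≤ ζ := by
  have h1 := (isMeanDominant_eval L).cusumVec_add_le (f := f) h.noise_nonneg h.noise hl hlb hbr hr
  rw [(isMeanDominant_eval L).cusumVec_of_const hlb hbr
    (h.signal.eq_of_no_change hl hr hno)] at h1
  rw [contrast_eq]
  linarith [h.noise_nonneg, h.le_threshold]

theorem searchInterval_bounds (lam s e p j : ℕ) :
    s ≤ (searchInterval lam s e p j).1 ∧ (searchInterval lam s e p j).2 ≤ e := by
  unfold searchInterval leftPt rightPt
  dsimp only
  split_ifs <;> exact ⟨le_max_right _ _, min_le_right _ _⟩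

theorem DetectionRegime.firstDetection_eq_none (h : DetectionRegime n L f ε T N τ lam ζ c)
    {s e : ℕ} (hs : 1 ≤ s) (heT : e ≤ T) (hno : ∀ j, 1 ≤ j → j ≤ N → s ≤ τ j → e ≤ τ j) :
    firstDetection L (fun t k => f t k + ε t k) lam ζ s e = none := by
  unfold firstDetection
  dsimp only
  refine find?_map_range'_eq_none _ _ _ fun j _ _ => ?_
  rw [decide_eq_false_iff_not]
  rintro ⟨b, hb, hlt⟩
  rw [Finset.mem_Ico] at hb
  obtain ⟨b1, b2⟩ := searchInterval_bounds lam s e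
    (largestDiff L (fun t k => f t k + ε t k) s e) j
  refine absurd hlt (not_lt.2 (h.contrast_le_of_no_change (by omega) (by omega) hb.1 hb.2 ?_))
  intro i i1 i2 i3
  have := hno i i1 i2 (by omega)
  omega

/-- The signal on an interval with exactly one change. -/
theorem IsPiecewiseConstant.step_of_isolated (hf : IsPiecewiseConstant T N τ f) {l r j : ℕ}
    (hl : 1 ≤ l) (hr : r ≤ T) (hlj : l ≤ τ j) (hjr : τ j < r)
    (hiso : ∀ i, 1 ≤ i → i ≤ N → l ≤ τ i → τ i < r → i = j) :
    (∀ t, l ≤ t → t ≤ τ j → f t = f (τ j)) ∧ (∀ t, τ j < t → t ≤ r → f t = f (τ j + 1)) := by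
  constructor
  · have h1 := hf.eq_of_no_change hl (e := τ j) (by omega) (fun i i1 i2 i3 => by
      by_contra! hlt
      have := hiso i i1 i2 i3 (by omega)
      subst this
      omega)
    intro t a b
    rw [h1 t a b, h1 (τ j) hlj le_rfl]
  · refine fun t a b => hf.eq_of_no_change (s := τ j + 1) (by omega) hr
      (fun i i1 i2 i3 => ?_) t a b
    by_contra! hlt
    have := hiso i i1 i2 (by omega) hlt
    subst this
    omega

theorem largestDiff_mem (X : ℕ → Fin d → ℝ) {s e : ℕ} (hse : s < e) :
    s ≤ largestDiff L X s e ∧ largestDiff L X s e < e := by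
  have := (argmax_spec (A := Finset.Ico s e) ⟨s, by simp [hse]⟩
    (fun t => L.eval (fun k => |X (t + 1) k - X t k|))).1
  rwa [Finset.mem_Ico] at this

/-- Started on an interval containing sufficiently interior changes, the search detects in an
interval which contains exactly one of them and stays away from the others. -/
theorem DetectionRegime.exists_firstDetection (h : DetectionRegime n L f ε T N τ lam ζ c)
    {s e : ℕ} (hs : 1 ≤ s) (heT : e ≤ T) (hse : s < e)
    (hadm : AdmissibleStart n T N τ (largestDiff L (fun t k => f t k + ε t k) s e))
    (hex : ∃ j, 1 ≤ j ∧ j ≤ N ∧ s ≤ τ j ∧ τ j < e)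
    (hint : ∀ j, 1 ≤ j → j ≤ N → s ≤ τ j → τ j < e →
      (minGap N τ : ℝ) / (2 * n) / 2 ≤ (τ j : ℝ) - s + 1 ∧
      (minGap N τ : ℝ) / (2 * n) / 2 ≤ (e : ℝ) - τ j) :
    ∃ j, ∃ I : ℕ × ℕ, 1 ≤ j ∧ j ≤ N ∧ I.1 ≤ τ j ∧ τ j < I.2 ∧
      firstDetection L (fun t k => f t k + ε t k) lam ζ s e = some I ∧
      (∃ b ∈ Finset.Ico I.1 I.2, ζ < contrast L (fun t k => f t k + ε t k) I.1 I.2 b) ∧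
      ∀ i, 1 ≤ i → i ≤ N → s ≤ τ i → τ i < e → i ≠ j →
        (τ i : ℝ) + (minGap N τ : ℝ) / (2 * n) / 2 ≤ I.1 ∨
        (I.2 : ℝ) + (minGap N τ : ℝ) / (2 * n) / 2 ≤ τ i := by
  obtain ⟨hp1, hp2⟩ := largestDiff_mem (L := L) (fun t k => f t k + ε t k) hse
  obtain ⟨j, ⟨j1, j2, j3, j4⟩, hfar⟩ := exists_closest_change h.three_halves_le h.signal hadm hex
  unfold firstDetection
  dsimp only
  generalize largestDiff L (fun t k => f t k + ε t k) s e = p at *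
  obtain ⟨m, hm, hml, hmr, hsep⟩ := exists_isolating_expansion (p := p) h.lam_pos h.lam_le
    (hint j j1 j2 j3 j4).1 (hint j j1 j2 j3 j4).2
  obtain ⟨i₀, hi1, hi2, hi3⟩ := exists_searchInterval_eq (e := e) h.lam_pos hp1 hp2.le hm
  have hu : 1 ≤ (minGap N τ : ℝ) / (2 * n) := by
    have : (1 : ℝ) ≤ lam := by exact_mod_cast h.lam_pos
    linarith [h.lam_le]
  have hthr := h.threshold_lt j j1 j2
  generalize (minGap N τ : ℝ) / (2 * n) = u at *
  have hbd := searchInterval_bounds lam s e p i₀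
  rw [hi3] at hbd
  dsimp only at hbd
  have hlj : leftPt lam s p m ≤ τ j := by
    have : (leftPt lam s p m : ℝ) < τ j + 1 := by linarith
    have : leftPt lam s p m < τ j + 1 := by exact_mod_cast this
    omega
  have hjr : τ j < rightPt lam e p m := by
    have : (τ j : ℝ) < rightPt lam e p m := by linarith
    exact_mod_cast this
  have hout : ∀ i, 1 ≤ i → i ≤ N → s ≤ τ i → τ i < e → i ≠ j →
      (τ i : ℝ) + u / 2 ≤ leftPt lam s p m ∨ (rightPt lam e p m : ℝ) + u / 2 ≤ τ i :=
    fun i a1 a2 a3 a4 a5 => hsep _ (hfar i a1 a2 a3 a4 a5)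
  have hiso : ∀ i, 1 ≤ i → i ≤ N → leftPt lam s p m ≤ τ i → τ i < rightPt lam e p m →
      i = j := by
    intro i a1 a2 a3 a4
    by_contra hne
    have b3 : (leftPt lam s p m : ℝ) ≤ τ i := by exact_mod_cast a3
    have b4 : (τ i : ℝ) < rightPt lam e p m := by exact_mod_cast a4
    rcases hout i a1 a2 (by omega) (by omega) hne with h' | h' <;> linarith
  obtain ⟨s1, s2⟩ := h.signal.step_of_isolated (by omega) (by omega) hlj hjr hiso
  have hdet := (isMeanDominant_eval L).lt_cusumVec_of_step h.noise_nonneg h.noise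
    (by omega) (by omega) hlj hjr s1 s2 hml hmr
    (by rw [← (isMeanDominant_eval L).jumpVec]; exact hthr)
  rw [← contrast_eq] at hdet
  classical
  obtain ⟨i, k1, k2, k3, k4⟩ := find?_map_range'_eq_some
    (fun I : ℕ × ℕ => decide (∃ b ∈ Finset.Ico I.1 I.2,
      ζ < contrast L (fun t k => f t k + ε t k) I.1 I.2 b))
    (searchInterval lam s e p) _ i₀ hi1 hi2 (by
      rw [hi3, decide_eq_true_eq]
      exact ⟨τ j, by rw [Finset.mem_Ico]; exact ⟨hlj, hjr⟩, hdet⟩)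
  rw [decide_eq_true_eq] at k3
  have hmono := searchInterval_mono lam s e p k2
  rw [hi3] at hmono
  dsimp only at hmono
  have hbd2 := searchInterval_bounds lam s e p i
  generalize searchInterval lam s e p i = I at *
  -- `I` lies inside the isolating expansion, whose only change is `τ j`; if `I` missed it, the
  -- contrast there would be pure noise and could not exceed ζ.
  have hmem : I.1 ≤ τ j ∧ τ j < I.2 := by
    by_contra hnot
    obtain ⟨b, hb, hlt⟩ := k3
    rw [Finset.mem_Ico] at hb
    refine absurd hlt (not_lt.2
      (h.contrast_le_of_no_change (by omega) (by omega) hb.1 hb.2 fun a a1 a2 a3 => ?_))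
    by_contra! a4
    have := hiso a a1 a2 (by omega) (by omega)
    subst this
    exact hnot ⟨a3, a4⟩
  refine ⟨j, I, j1, j2, hmem.1, hmem.2, ?_, k3, fun a a1 a2 a3 a4 a5 => ?_⟩
  · convert k4
  · have c1 : (leftPt lam s p m : ℝ) ≤ I.1 := by exact_mod_cast hmono.1
    have c2 : (I.2 : ℝ) ≤ rightPt lam e p m := by exact_mod_cast hmono.2
    rcases hout a a1 a2 a3 a4 a5 with h' | h'
    · left; linarith
    · right; linarith

/-- The localisation error of the detection `D` of the `j`-th change is at most `B` in the
scale of the jump size. -/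
def Locates (L : AggNorm) (f X : ℕ → Fin d → ℝ) (τ : ℕ → ℕ) (B : ℝ) (j : ℕ) (D : Detection) :
    Prop :=
  ∀ q : Fin d, (∀ k, absCusum X D.left D.right D.loc k ≤ absCusum X D.left D.right D.loc q) →
    |(D.loc : ℝ) - τ j| * jumpSize L f τ j q ^ 2 ≤ B

theorem DetectionRegime.locates (h : DetectionRegime n L f ε T N τ lam ζ c) {l r j : ℕ}
    (hl : 1 ≤ l) (hr : r ≤ T) (hj : j ≤ N) (hlj : l ≤ τ j) (hjr : τ j < r)
    (hiso : ∀ i, 1 ≤ i → i ≤ N → l ≤ τ i → τ i < r → i = j)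
    (hdet : ∃ b ∈ Finset.Ico l r, ζ < contrast L (fun t k => f t k + ε t k) l r b) :
    Locates L f (fun t k => f t k + ε t k) τ (8 * c ^ 2) j
      ⟨argmax (Finset.Ico l r) (contrast L (fun t k => f t k + ε t k) l r), l, r⟩ := by
  obtain ⟨s1, s2⟩ := h.signal.step_of_isolated hl hr hlj hjr hiso
  obtain ⟨m1, m2⟩ := argmax_spec (A := Finset.Ico l r) ⟨τ j, by simp [hlj, hjr]⟩
    (contrast L (fun t k => f t k + ε t k) l r)
  intro q hq
  dsimp only at hq ⊢
  generalize argmax (Finset.Ico l r) (contrast L (fun t k => f t k + ε t k) l r) = b at *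
  obtain ⟨b', hb', hlt⟩ := hdet
  have hb := hlt.trans_le (m2 b' hb')
  have hmax := m2 (τ j) (by simp [hlj, hjr])
  rw [Finset.mem_Ico] at m1
  cases L with
  | L2 =>
    rw [contrast_eq] at hb
    rw [contrast_eq, contrast_eq] at hmax
    have := isQuadratic_L2.dist_mul_sq_le h.noise_nonneg h.noise hl hr hlj hjr s1 s2 m1.1 m1.2
      h.le_threshold hb hmax
    rwa [← isQuadratic_L2.toIsMeanDominant.jumpVec] at this
  | Linf =>
    -- At the estimate the supremum is attained by q, and at the true change it dominates coordinate
    -- q. So the maximality of the estimate passes to the seminorm |x q|, which is quadratic.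
    have hbq : contrast .Linf (fun t k => f t k + ε t k) l r b =
        |cusumVec (fun t k => f t k + ε t k) l r b q| := by
      have : Nonempty (Fin d) := ⟨q⟩
      refine le_antisymm ?_ ?_
      · rw [contrast_eq]
        exact ciSup_le hq
      · rw [contrast_eq]
        exact le_ciSup (f := fun i => |cusumVec (fun t k => f t k + ε t k) l r b i|)
          (Set.finite_range _).bddAbove q
    have hτq : |cusumVec (fun t k => f t k + ε t k) l r (τ j) q| ≤
        contrast .Linf (fun t k => f t k + ε t k) l r (τ j) := by
      rw [contrast_eq]
      exact le_ciSup (f := fun i => |cusumVec (fun t k => f t k + ε t k) l r (τ j) i|)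
        (Set.finite_range _).bddAbove q
    rw [hbq] at hb
    have := (isQuadratic_coord q).dist_mul_sq_le h.noise_nonneg h.noise hl hr hlj hjr s1 s2
      m1.1 m1.2 h.le_threshold hb (by rw [← hbq]; exact hτq.trans hmax)
    -- The jump size for L_∞ is written with the right end of the next constant piece instead of its
    -- left end.
    have hnext : f (τ (j + 1)) = f (τ j + 1) := by
      obtain ⟨μ, hμ⟩ := h.signal.const j hj
      have := h.signal.r_lt j hj
      rw [hμ _ this le_rfl, hμ (τ j + 1) (by omega) (by omega)]
    simp only [jumpSize, hnext]
    exact this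

/-! ### The recursion -/

theorem IsCall.bounds {X : ℕ → Fin d → ℝ} {s e : ℕ} (h : IsCall L X lam ζ T s e) :
    1 ≤ s ∧ e ≤ T := by
  induction h with
  | start => exact ⟨le_rfl, le_rfl⟩
  | goLeft _ _ hI ih => have := firstDetection_bounds hI; omega
  | goRight _ _ hI ih => have := firstDetection_bounds hI; omega

/-- MDAIS on an interval whose changes are the sufficiently interior `τ a, …, τ (b - 1)`. -/
theorem DetectionRegime.forall₂_mdais (h : DetectionRegime n L f ε T N τ lam ζ c)
    (hA : LargestDiffCondition n L (fun t k => f t k + ε t k) lam ζ T N τ) {s e : ℕ}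
    (hcall : IsCall L (fun t k => f t k + ε t k) lam ζ T s e)
    (hint : ∀ j, 1 ≤ j → j ≤ N → s ≤ τ j → τ j < e →
      (minGap N τ : ℝ) / (2 * n) / 2 ≤ (τ j : ℝ) - s + 1 ∧
      (minGap N τ : ℝ) / (2 * n) / 2 ≤ (e : ℝ) - τ j)
    {a b : ℕ} (ha : 1 ≤ a) (hab : a ≤ b) (hbN : b ≤ N + 1)
    (hvis : ∀ j, 1 ≤ j → j ≤ N → (s ≤ τ j ∧ τ j < e ↔ a ≤ j ∧ j < b)) :
    List.Forall₂ (Locates L f (fun t k => f t k + ε t k) τ (8 * c ^ 2)) (List.range' a (b - a))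
      (mdais L (fun t k => f t k + ε t k) lam ζ s e) := by
  obtain ⟨hs, heT⟩ := hcall.bounds
  have hu : 1 ≤ (minGap N τ : ℝ) / (2 * n) := by
    have : (1 : ℝ) ≤ lam := by exact_mod_cast h.lam_pos
    linarith [h.lam_le]
  induction hk : e - s using Nat.strong_induction_on generalizing s e a b with
  | _ k ih =>
  rcases hab.eq_or_lt with heq | hlt
  -- No change is visible, so the recursion stops without output.
  · have hnone : firstDetection L (fun t k => f t k + ε t k) lam ζ s e = none := by
      refine h.firstDetection_eq_none hs heT fun j j1 j2 j3 => ?_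
      by_contra! j4
      have := (hvis j j1 j2).1 ⟨j3, j4⟩
      omega
    have : mdais L (fun t k => f t k + ε t k) lam ζ s e = [] := by
      rw [mdais]
      split_ifs
      · split
        · rfl
        · rename_i I hI
          rw [hnone] at hI
          exact absurd hI (by simp)
      · rfl
    rw [this, heq, Nat.sub_self]
    exact List.Forall₂.nil
  · have hva := (hvis a ha (by omega)).2 ⟨le_rfl, hlt⟩
    have hse : s < e := by omega
    have hex : ∃ j, 1 ≤ j ∧ j ≤ N ∧ s ≤ τ j ∧ τ j < e := ⟨a, ha, by omega, hva⟩
    obtain ⟨j, I, j1, j2, j3, j4, hI, hdet, hsep⟩ := h.exists_firstDetection hs heT hse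
      (hA s e hcall hex) hex hint
    obtain ⟨I1, I2, I3⟩ := firstDetection_bounds hI
    obtain ⟨ja, jb⟩ := (hvis j j1 j2).1 ⟨by omega, by omega⟩
    have hrec : mdais L (fun t k => f t k + ε t k) lam ζ s e =
        mdais L (fun t k => f t k + ε t k) lam ζ s I.1
          ++ [⟨argmax (Finset.Ico I.1 I.2) (contrast L (fun t k => f t k + ε t k) I.1 I.2),
            I.1, I.2⟩]
          ++ mdais L (fun t k => f t k + ε t k) lam ζ I.2 e := by
      rw [mdais, if_pos hse]
      split
      · rename_i hnone
        rw [hI] at hnone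
        exact absurd hnone (by simp)
      · rename_i I' hI'
        rw [hI] at hI'
        obtain rfl := Option.some.inj hI'
        rfl
    have hrange : List.range' a (b - a) =
        List.range' a (j - a) ++ [j] ++ List.range' (j + 1) (b - (j + 1)) := by
      have e1 := List.range'_append_1 (s := a) (m := j - a) (n := b - j)
      rw [show a + (j - a) = j by omega, show j - a + (b - j) = b - a by omega] at e1
      rw [← e1, show b - j = (b - (j + 1)) + 1 by omega, List.range'_succ]
      simp
    -- The order of the changes decides which side of `I` each other change is on; the separation
    -- u/2 becomes its depth at the new end-point of the recursive call.
    have hleft : ∀ i, 1 ≤ i → i ≤ N → s ≤ τ i → i < j →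
        (τ i : ℝ) + (minGap N τ : ℝ) / (2 * n) / 2 ≤ I.1 := by
      intro i i1 i2 i3 hij
      have hτ := h.signal.lt_of_lt hij (by omega)
      refine (hsep i i1 i2 i3 (by omega) (by omega)).resolve_right fun h' => ?_
      have : (I.2 : ℝ) ≤ τ i := by linarith
      have : I.2 ≤ τ i := by exact_mod_cast this
      omega
    have hright : ∀ i, 1 ≤ i → i ≤ N → τ i < e → j < i →
        (I.2 : ℝ) + (minGap N τ : ℝ) / (2 * n) / 2 ≤ τ i := by
      intro i i1 i2 i3 hij
      have hτ := h.signal.lt_of_lt hij (by omega)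
      refine (hsep i i1 i2 (by omega) i3 (by omega)).resolve_left fun h' => ?_
      have : (τ i : ℝ) ≤ I.1 := by linarith
      have : τ i ≤ I.1 := by exact_mod_cast this
      omega
    have hleft' : ∀ i, 1 ≤ i → i ≤ N → s ≤ τ i → i < j → τ i < I.1 := by
      intro i i1 i2 i3 hij
      have := hleft i i1 i2 i3 hij
      have : (τ i : ℝ) < I.1 := by linarith
      exact_mod_cast this
    have hright' : ∀ i, 1 ≤ i → i ≤ N → τ i < e → j < i → I.2 < τ i := by
      intro i i1 i2 i3 hij
      have := hright i i1 i2 i3 hij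
      have : (I.2 : ℝ) < τ i := by linarith
      exact_mod_cast this
    have hle : ∀ i, j ≤ i → i ≤ N → τ j ≤ τ i := fun i hi hiN =>
      h.signal.le_of_le hi (by omega)
    have hge : ∀ i, i ≤ j → τ i ≤ τ j := fun i hi => h.signal.le_of_le hi (by omega)
    rw [hrec, hrange]
    refine List.rel_append (List.rel_append ?_ ?_) ?_
    · refine ih (I.1 - s) (by omega) (hcall.goLeft hse hI) ?_ ha ja (by omega) ?_ hs
        (by omega) rfl
      · intro i i1 i2 i3 i4
        have hij : i < j := by
          by_contra! h'
          have := hle i h' i2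
          omega
        exact ⟨(hint i i1 i2 i3 (by omega)).1, by linarith [hleft i i1 i2 i3 hij]⟩
      · intro i i1 i2
        have hv := hvis i i1 i2
        constructor
        · rintro ⟨q1, q2⟩
          refine ⟨(hv.1 ⟨q1, by omega⟩).1, ?_⟩
          by_contra! h'
          have := hle i h' i2
          omega
        · rintro ⟨q1, q2⟩
          have := (hv.2 ⟨q1, by omega⟩).1
          exact ⟨this, hleft' i i1 i2 this q2⟩
    · refine List.Forall₂.cons (h.locates (by omega) (by omega) j2 j3 j4 ?_ hdet)
        List.Forall₂.nil
      intro i i1 i2 i3 i4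
      by_contra hne
      rcases lt_or_gt_of_ne hne with h' | h'
      · have := hleft' i i1 i2 (by omega) h'; omega
      · have := hright' i i1 i2 (by omega) h'; omega
    · refine ih (e - I.2) (by omega) (hcall.goRight hse hI) ?_ (by omega) jb hbN ?_ (by omega)
        heT rfl
      · intro i i1 i2 i3 i4
        have hij : j < i := by
          by_contra! h'
          have := hge i h'
          omega
        exact ⟨by linarith [hright i i1 i2 i4 hij], (hint i i1 i2 (by omega) i4).2⟩
      · intro i i1 i2
        have hv := hvis i i1 i2
        constructor
        · rintro ⟨q1, q2⟩
          refine ⟨?_, (hv.1 ⟨by omega, q2⟩).2⟩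
          by_contra! h'
          have := hge i (by omega)
          omega
        · rintro ⟨q1, q2⟩
          have := (hv.2 ⟨by omega, q2⟩).2
          exact ⟨(hright' i i1 i2 this (by omega)).le, this⟩

theorem DetectionRegime.recovers (h : DetectionRegime n L f ε T N τ lam ζ c)
    (hA : LargestDiffCondition n L (fun t k => f t k + ε t k) lam ζ T N τ) :
    Recovers L (fun t k => f t k + ε t k) (mdais L (fun t k => f t k + ε t k) lam ζ 1 T) N τ f
      (8 * c ^ 2) := by
  have hδ : (0 : ℝ) < minGap N τ := by exact_mod_cast h.signal.minGap_pos
  have hn := h.three_halves_le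
  have hu : (minGap N τ : ℝ) / (2 * n) / 2 ≤ minGap N τ := by
    rw [div_div, div_le_iff₀ (by linarith)]
    nlinarith
  have hvis : ∀ j, 1 ≤ j → j ≤ N → minGap N τ ≤ τ j ∧ τ j + minGap N τ ≤ T := by
    intro j j1 j2
    have q1 := h.signal.add_minGap_le_of_lt (i := 0) (j := j) (by omega) (by omega)
    have q2 := h.signal.add_minGap_le_of_lt (i := j) (j := N + 1) (by omega) le_rfl
    rw [h.signal.r_zero] at q1
    rw [h.signal.r_last] at q2
    omega
  have hmin := h.signal.minGap_pos
  -- On [1,T] every change is at least the minimal gap away from both ends, more than the depth u/2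
  -- required.
  have key := h.forall₂_mdais hA IsCall.start (a := 1) (b := N + 1) (fun j j1 j2 _ _ => by
      obtain ⟨q1, q2⟩ := hvis j j1 j2
      have q1' : (minGap N τ : ℝ) ≤ τ j := by exact_mod_cast q1
      have q2' : (τ j : ℝ) + minGap N τ ≤ T := by exact_mod_cast q2
      push_cast
      constructor <;> linarith) le_rfl (by omega) le_rfl (fun j j1 j2 => by
      have := hvis j j1 j2
      constructor <;> intro <;> omega)
  rw [Nat.add_sub_cancel] at key
  have hlen := key.length_eq
  rw [List.length_range'] at hlen
  refine ⟨hlen.symm, fun j j1 j2 D hD => ?_⟩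
  obtain ⟨hj, hget⟩ := List.getElem?_eq_some_iff.1 hD
  have := key.get (i := j - 1) (by rw [List.length_range']; omega) hj
  simp only [List.get_eq_getElem, List.getElem_range', hget] at this
  rwa [show 1 + 1 * (j - 1) = j by omega] at this

end

section

/-! ### The size of the noise -/

theorem hasSubgaussianMGF_id_gaussianReal (v : NNReal) :
    HasSubgaussianMGF id v (gaussianReal 0 v) where
  integrable_exp_mul t := integrable_exp_mul_gaussianReal t
  mgf_le t := by rw [mgf_id_gaussianReal]; simp

/-- The weights of the observations in the CUSUM statistic. -/
noncomputable def cusumWeight (s e b t : ℕ) : ℝ :=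
  (if t ∈ Finset.Icc s b then √(((e : ℝ) - b) / (((e : ℝ) - s + 1) * ((b : ℝ) - s + 1))) else 0)
    - if t ∈ Finset.Icc (b + 1) e then
      √(((b : ℝ) - s + 1) / (((e : ℝ) - s + 1) * ((e : ℝ) - b))) else 0

variable {T s e b : ℕ}

theorem cusum_eq_sum_weight (x : ℕ → ℝ) (hs : 1 ≤ s) (hsb : s ≤ b) (hbe : b < e) (heT : e ≤ T) :
    cusum x s e b = ∑ t ∈ Finset.Icc 1 T, cusumWeight s e b t * x t := by
  have h1 : (Finset.Icc 1 T).filter (· ∈ Finset.Icc s b) = Finset.Icc s b := by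
    ext t; simp only [Finset.mem_filter, Finset.mem_Icc]; omega
  have h2 : (Finset.Icc 1 T).filter (· ∈ Finset.Icc (b + 1) e) = Finset.Icc (b + 1) e := by
    ext t; simp only [Finset.mem_filter, Finset.mem_Icc]; omega
  simp only [cusumWeight, sub_mul, ite_mul, zero_mul, Finset.sum_sub_distrib,
    ← Finset.sum_filter, h1, h2, ← Finset.mul_sum]
  rfl

/-- The two blocks contribute (e - b)/ℓ and (b - s + 1)/ℓ with ℓ = e - s + 1. Unit norm makes the
noise level independent of the interval and the location. -/
theorem sum_cusumWeight_sq (hs : 1 ≤ s) (hsb : s ≤ b) (hbe : b < e) (heT : e ≤ T) :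
    ∑ t ∈ Finset.Icc 1 T, cusumWeight s e b t ^ 2 = 1 := by
  have q1 : (s : ℝ) ≤ b := by exact_mod_cast hsb
  have q2 : (b : ℝ) < e := by exact_mod_cast hbe
  have p1 : (0 : ℝ) < (b : ℝ) - s + 1 := by linarith
  have p2 : (0 : ℝ) < (e : ℝ) - b := by linarith
  have p3 : (0 : ℝ) < (e : ℝ) - s + 1 := by linarith
  have h1 : (Finset.Icc 1 T).filter (· ∈ Finset.Icc s b) = Finset.Icc s b := by
    ext t; simp only [Finset.mem_filter, Finset.mem_Icc]; omega
  have h2 : (Finset.Icc 1 T).filter (· ∈ Finset.Icc (b + 1) e) = Finset.Icc (b + 1) e := by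
    ext t; simp only [Finset.mem_filter, Finset.mem_Icc]; omega
  have hsq : ∀ t, cusumWeight s e b t ^ 2 =
      (if t ∈ Finset.Icc s b then ((e : ℝ) - b) / (((e : ℝ) - s + 1) * ((b : ℝ) - s + 1)) else 0)
      + if t ∈ Finset.Icc (b + 1) e then
        ((b : ℝ) - s + 1) / (((e : ℝ) - s + 1) * ((e : ℝ) - b)) else 0 := by
    intro t
    unfold cusumWeight
    by_cases m1 : t ∈ Finset.Icc s b
    · have m2 : t ∉ Finset.Icc (b + 1) e := by
        simp only [Finset.mem_Icc] at m1 ⊢; omega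
      rw [if_pos m1, if_neg m2, if_pos m1, if_neg m2, sub_zero, add_zero,
        Real.sq_sqrt (by positivity)]
    · rw [if_neg m1, if_neg m1, zero_sub, neg_sq, zero_add]
      by_cases m2 : t ∈ Finset.Icc (b + 1) e
      · rw [if_pos m2, if_pos m2, Real.sq_sqrt (by positivity)]
      · rw [if_neg m2, if_neg m2]; simp
  have c1 : ((b + 1 - s : ℕ) : ℝ) = (b : ℝ) - s + 1 := by
    rw [Nat.cast_sub (by omega)]; push_cast; ring
  have c2 : ((e + 1 - (b + 1) : ℕ) : ℝ) = (e : ℝ) - b := by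
    rw [Nat.cast_sub (by omega)]; push_cast; ring
  simp only [hsq, Finset.sum_add_distrib, ← Finset.sum_filter, h1, h2, Finset.sum_const,
    Nat.card_Icc, nsmul_eq_mul, c1, c2]
  field_simp
  ring

variable {d : ℕ} {S : Matrix (Fin d) (Fin d) ℝ} {Ω : Type*} [MeasurableSpace Ω] {P : Measure Ω}
  {ε : ℕ → Ω → EuclideanSpace ℝ (Fin d)}

theorem hasSubgaussianMGF_coord (hS : S.PosSemidef) {X : Ω → EuclideanSpace ℝ (Fin d)}
    (hX : HasLaw X (multivariateGaussian 0 S) P) (k : Fin d) :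
    HasSubgaussianMGF (fun ω => X ω k) (S k k).toNNReal P := by
  have h1 := measurePreserving_eval_multivariateGaussian (μ := 0) hS (i := k)
  have h2 : HasSubgaussianMGF id (S k k).toNNReal
      ((multivariateGaussian 0 S).map (fun x : EuclideanSpace ℝ (Fin d) => x k)) := by
    rw [h1.map_eq]
    exact hasSubgaussianMGF_id_gaussianReal _
  rw [← hX.map_eq] at h2
  have h3 := HasSubgaussianMGF.of_map h1.measurable.aemeasurable h2
  exact HasSubgaussianMGF.of_map hX.aemeasurable h3

theorem hasSubgaussianMGF_cusum (hS : S.PosSemidef)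
    (hlaw : ∀ t ∈ Finset.Icc 1 T, HasLaw (ε t) (multivariateGaussian 0 S) P)
    (hind : iIndepFun (fun t : Finset.Icc 1 T => ε t) P)
    (hs : 1 ≤ s) (hsb : s ≤ b) (hbe : b < e) (heT : e ≤ T) (k : Fin d) :
    HasSubgaussianMGF (fun ω => cusum (fun t => ε t ω k) s e b) (S k k).toNNReal P := by
  have hcoord := fun t (ht : t ∈ Finset.Icc 1 T) => hasSubgaussianMGF_coord hS (hlaw t ht) k
  generalize (S k k).toNNReal = v at hcoord ⊢
  have hind' := hind.comp (fun t (x : EuclideanSpace ℝ (Fin d)) => cusumWeight s e b t * x k)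
    (fun t => by fun_prop)
  have h := HasSubgaussianMGF.sum_of_iIndepFun hind' (s := Finset.univ)
    (fun t _ => (hcoord t t.2).const_mul (cusumWeight s e b t))
  convert h using 1
  · ext ω
    rw [cusum_eq_sum_weight _ hs hsb hbe heT, ← Finset.sum_coe_sort]
    rfl
  · refine NNReal.eq (Eq.trans ?_ (NNReal.coe_sum _ _).symm)
    change (v : ℝ) = ∑ t : Finset.Icc 1 T, cusumWeight s e b t ^ 2 * (v : ℝ)
    rw [← Finset.sum_mul, Finset.sum_coe_sort (Finset.Icc 1 T) (fun t => cusumWeight s e b t ^ 2),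
      sum_cusumWeight_sq hs hsb hbe heT, one_mul]

theorem measureReal_lt_abs_cusum_le [IsProbabilityMeasure P] (hS : S.PosDef) {σ : ℝ}
    (hσ : ∀ k, S k k ≤ σ ^ 2)
    (hlaw : ∀ t ∈ Finset.Icc 1 T, HasLaw (ε t) (multivariateGaussian 0 S) P)
    (hind : iIndepFun (fun t : Finset.Icc 1 T => ε t) P)
    (hs : 1 ≤ s) (hsb : s ≤ b) (hbe : b < e) (heT : e ≤ T) (k : Fin d) {c : ℝ} (hc : 0 ≤ c) :
    P.real {ω | c < |cusum (fun t => ε t ω k) s e b|} ≤ 2 * Real.exp (-c ^ 2 / (2 * σ ^ 2)) := by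
  have h := hasSubgaussianMGF_cusum hS.posSemidef hlaw hind hs hsb hbe heT k
  -- A zero variance would make the exponent a division by zero, hence the bound exp 0 = 1, and the
  -- comparison with σ² would fail.
  have hk : 0 < S k k := hS.diag_pos
  have hexp : Real.exp (-c ^ 2 / (2 * ((S k k).toNNReal : ℝ))) ≤
      Real.exp (-c ^ 2 / (2 * σ ^ 2)) := by
    rw [Real.coe_toNNReal _ hk.le, neg_div, neg_div]
    have := hσ k
    gcongr
  have h1 := (h.measure_ge_le hc).trans hexp
  have h2 := (h.neg.measure_ge_le hc).trans hexp
  have hsub : {ω | c < |cusum (fun t => ε t ω k) s e b|} ⊆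
      {ω | c ≤ cusum (fun t => ε t ω k) s e b} ∪
        {ω | c ≤ (-fun ω => cusum (fun t => ε t ω k) s e b) ω} := by
    intro ω hω
    rcases lt_abs.1 (show c < |_| from hω) with h' | h'
    · exact Or.inl h'.le
    · exact Or.inr h'.le
  calc _ ≤ _ := measureReal_mono hsub
    _ ≤ _ := measureReal_union_le _ _
    _ ≤ _ := by linarith

theorem measureReal_not_cusumBounded_le [IsProbabilityMeasure P] (hS : S.PosDef) {σ : ℝ}
    (hσ : ∀ k, S k k ≤ σ ^ 2)
    (hlaw : ∀ t ∈ Finset.Icc 1 T, HasLaw (ε t) (multivariateGaussian 0 S) P)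
    (hind : iIndepFun (fun t : Finset.Icc 1 T => ε t) P) {c : ℝ} (hc : 0 ≤ c) :
    P.real {ω | ¬ CusumBounded T (fun t k => ε t ω k) c} ≤
      (T : ℝ) ^ 3 * d * (2 * Real.exp (-c ^ 2 / (2 * σ ^ 2))) := by
  classical
  set A : Finset (((ℕ × ℕ) × ℕ) × Fin d) :=
    ((Finset.Icc 1 T ×ˢ Finset.Icc 1 T) ×ˢ Finset.Icc 1 T) ×ˢ Finset.univ with hA
  have hsub : {ω | ¬ CusumBounded T (fun t k => ε t ω k) c} ⊆
      ⋃ x ∈ A.filter (fun x => x.1.1.1 ≤ x.1.1.2 ∧ x.1.1.2 < x.1.2),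
        {ω | c < |cusum (fun t => ε t ω x.2) x.1.1.1 x.1.2 x.1.1.2|} := by
    intro ω hω
    simp only [CusumBounded, Set.mem_ofPred_eq, not_forall, not_le] at hω
    obtain ⟨s, b, e, h1, h2, h3, h4, k, h5⟩ := hω
    refine Set.mem_biUnion (x := (((s, b), e), k)) ?_ h5
    simp only [hA, Finset.mem_coe, Finset.mem_filter, Finset.mem_product, Finset.mem_Icc,
      Finset.mem_univ]
    exact ⟨⟨⟨⟨⟨h1, by omega⟩, by omega, by omega⟩, by omega, h4⟩, trivial⟩, h2, h3⟩
  calc _ ≤ _ := measureReal_mono hsub (measure_ne_top _ _)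
    _ ≤ ∑ x ∈ A.filter (fun x => x.1.1.1 ≤ x.1.1.2 ∧ x.1.1.2 < x.1.2),
        P.real {ω | c < |cusum (fun t => ε t ω x.2) x.1.1.1 x.1.2 x.1.1.2|} :=
      measureReal_biUnion_finset_le _ _
    _ ≤ ∑ x ∈ A.filter (fun x => x.1.1.1 ≤ x.1.1.2 ∧ x.1.1.2 < x.1.2),
        2 * Real.exp (-c ^ 2 / (2 * σ ^ 2)) := by
      refine Finset.sum_le_sum fun x hx => ?_
      simp only [hA, Finset.mem_filter, Finset.mem_product, Finset.mem_Icc, Finset.mem_univ] at hx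
      exact measureReal_lt_abs_cusum_le hS hσ hlaw hind (by omega) hx.2.1 hx.2.2 (by omega) _ hc
    _ ≤ ∑ x ∈ A, 2 * Real.exp (-c ^ 2 / (2 * σ ^ 2)) :=
      Finset.sum_le_sum_of_subset_of_nonneg (Finset.filter_subset _ _) fun _ _ _ => by positivity
    _ = _ := by
      simp only [hA, Finset.sum_const, Finset.card_product, Nat.card_Icc, Finset.card_univ,
        Fintype.card_fin, nsmul_eq_mul]
      push_cast
      ring

theorem logTd_nonneg (hT : 1 ≤ T) (hd : 1 ≤ d) : 0 ≤ logTd T d := by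
  have h1 : (1 : ℝ) ≤ T := by exact_mod_cast hT
  have h2 : (1 : ℝ) ≤ d := by exact_mod_cast hd
  exact Real.log_nonneg (one_le_mul_of_one_le_of_one_le h1 (Real.one_le_rpow h2 (by norm_num)))

/-- The exponential is T⁻⁸ d⁻², and the exponent 1/4 of d in the logarithm is enough to absorb the
factor d from the union over coordinates. -/
theorem union_bound_le (hT : 1 ≤ T) (hd : 1 ≤ d) :
    (T : ℝ) ^ 3 * d * (2 * Real.exp (-(8 * logTd T d))) ≤ 2 / T := by
  have h1 : (1 : ℝ) ≤ T := by exact_mod_cast hT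
  have h2 : (1 : ℝ) ≤ d := by exact_mod_cast hd
  have h3 : (0 : ℝ) < (T : ℝ) * (d : ℝ) ^ (1 / 4 : ℝ) :=
    mul_pos (by linarith) (Real.rpow_pos_of_pos (by linarith) _)
  have h4 : Real.exp (8 * logTd T d) = (T : ℝ) ^ 8 * (d : ℝ) ^ 2 := by
    rw [logTd, mul_comm, Real.exp_mul, Real.exp_log h3, Real.mul_rpow (by linarith) (by positivity),
      ← Real.rpow_mul (by linarith)]
    norm_num
  rw [Real.exp_neg, h4, ← div_eq_mul_inv, ← mul_div_assoc,
    div_le_div_iff₀ (by positivity) (by linarith)]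
  have h5 : (1 : ℝ) ≤ T ^ 4 * d :=
    one_le_mul_of_one_le_of_one_le (one_le_pow₀ h1) h2
  calc (T : ℝ) ^ 3 * d * 2 * T = 2 * ((T : ℝ) ^ 4 * d) * 1 := by ring
    _ ≤ 2 * ((T : ℝ) ^ 4 * d) * ((T : ℝ) ^ 4 * d) := by gcongr
    _ = 2 * ((T : ℝ) ^ 8 * (d : ℝ) ^ 2) := by ring

/-! ### Thresholds and signal strength -/

variable {N : ℕ} {τ : ℕ → ℕ} {f : ℕ → Fin d → ℝ} {L : AggNorm}

theorem minJump_le {j : ℕ} (h1 : 1 ≤ j) (h2 : j ≤ N) :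
    minJump L N τ f ≤ ENNReal.ofReal (L.eval (jumpVec f τ j)) :=
  iInf₂_le j (Finset.mem_Icc.2 ⟨h1, h2⟩)

/-- With κ = √(1/(8n)), the quantity Q = κ √δ_T L(Δ_j) bounds from below the signal CUSUM of a
change at depth δ_T/(4n). The threshold is below Q/2 and the noise 4σℓ is at most Q/25. -/
theorem threshold_add_noise_lt {n σ ζ ℓ : ℝ} (hn : 3 / 2 ≤ n)
    (hsig : ENNReal.ofReal (100 * σ / √(1 / (8 * n)) * ℓ) ≤
      ENNReal.ofReal √(minGap N τ : ℝ) * minJump L N τ f)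
    (hζ : ENNReal.ofReal ζ <
      ENNReal.ofReal (√(1 / (8 * n)) / 2 * √(minGap N τ : ℝ)) * minJump L N τ f)
    {j : ℕ} (h1 : 1 ≤ j) (h2 : j ≤ N) :
    ζ + 4 * σ * ℓ < √((minGap N τ : ℝ) / (2 * n) / 2 / 2) * L.eval (jumpVec f τ j) := by
  have hL := (isMeanDominant_eval L).nonneg (jumpVec f τ j)
  have hκ : 0 < √(1 / (8 * n)) := Real.sqrt_pos.2 (one_div_pos.2 (by linarith))
  have e1 : √((minGap N τ : ℝ) / (2 * n) / 2 / 2) = √(1 / (8 * n)) * √(minGap N τ : ℝ) := by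
    rw [← Real.sqrt_mul (one_div_pos.2 (by linarith)).le]
    congr 1
    field_simp
    norm_num
  -- Passing from the infimum to the single index j leaves only finite quantities, so both
  -- conditions become real inequalities.
  have a1 := hsig.trans (mul_le_mul_right (minJump_le h1 h2) _)
  have a2 := hζ.trans_le (mul_le_mul_right (minJump_le h1 h2) _)
  rw [← ENNReal.ofReal_mul (by positivity)] at a1 a2
  rw [ENNReal.ofReal_le_ofReal_iff (by positivity)] at a1
  have a3 := (ENNReal.ofReal_lt_ofReal_iff'.1 a2).1
  rw [e1]
  generalize √(1 / (8 * n)) = κ at *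
  have hg := Real.sqrt_nonneg (minGap N τ : ℝ)
  generalize √(minGap N τ : ℝ) = g at *
  generalize L.eval (jumpVec f τ j) = y at *
  rw [div_mul_eq_mul_div, div_le_iff₀ hκ] at a1
  have hpos := mul_nonneg (mul_nonneg hκ.le hg) hL
  linarith

end

end ChangePoint

/-! ### Choice of the constants and the probability bound. -/

open ChangePoint in
theorem theorem3 (n : ℝ) (hn : 3 / 2 ≤ n) (σ : ℝ) (hσ : 0 < σ) :
    ∃ CM C₁ C₂ C₃ C₄ : ℝ, 0 < CM ∧ 0 < C₁ ∧ 0 < C₂ ∧ 0 < C₃ ∧ 0 < C₄ ∧ C₁ < C₂ * CM ∧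
    ∃ T₀ : ℕ, ∀ T : ℕ, T₀ ≤ T → ∀ d : ℕ, 1 ≤ d →
    ∀ (L : AggNorm) (N : ℕ) (r : ℕ → ℕ) (f : ℕ → Fin d → ℝ), IsPiecewiseConstant T N r f →
    ∀ S : Matrix (Fin d) (Fin d) ℝ, S.PosDef → (∀ k, S k k ≤ σ ^ 2) →
    ∀ {Ω : Type*} [MeasurableSpace Ω] (P : Measure Ω) [IsProbabilityMeasure P]
      (ε : ℕ → Ω → EuclideanSpace ℝ (Fin d)),
      (∀ t ∈ Finset.Icc 1 T, HasLaw (ε t) (multivariateGaussian 0 S) P) →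
      iIndepFun (fun t : Finset.Icc 1 T => ε t) P →
    ENNReal.ofReal (CM * √(logTd T d)) ≤
      ENNReal.ofReal √(minGap N r : ℝ) * minJump L N r f →
    ∀ lam : ℕ, 1 ≤ lam → (lam : ℝ) ≤ (minGap N r : ℝ) / (2 * n) →
    ∀ ζ : ℝ, C₁ * √(logTd T d) ≤ ζ →
      ENNReal.ofReal ζ < ENNReal.ofReal (C₂ * √(minGap N r : ℝ)) * minJump L N r f →
    let X : Ω → ℕ → Fin d → ℝ := fun ω t k => f t k + ε t ω k
    1 - C₄ / (T : ℝ) ≤ P.real {ω |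
      LargestDiffCondition n L (X ω) lam ζ T N r →
        Recovers L (X ω) (mdais L (X ω) lam ζ 1 T) N r f (C₃ * logTd T d)} := by
  have hκ : 0 < √(1 / (8 * n)) := Real.sqrt_pos.2 (one_div_pos.2 (by linarith))
  -- With c = 4σ√log(T d^{1/4}): C₁ = 40σ gives 10c ≤ ζ, C₂ = √(1/(8n))/2 leaves half of the signal
  -- bound to the noise, and C₃ = 8·(4σ)² is the localisation bound 8c². Then C₂ times the first
  -- constant is 50σ > C₁.
  refine ⟨100 * σ / √(1 / (8 * n)), 40 * σ, √(1 / (8 * n)) / 2, 128 * σ ^ 2, 2, by positivity,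
    by positivity, by positivity, by positivity, by positivity, ?_, 0, ?_⟩
  · have : √(1 / (8 * n)) / 2 * (100 * σ / √(1 / (8 * n))) = 50 * σ := by
      field_simp
      norm_num
    linarith
  intro T _ d hd L N r f hf S hS hSσ Ω _ P _ ε hlaw hind hsig lam hlam hlam' ζ hζ hζ' X
  -- The pieces of the signal are nonempty, so T ≥ 1 is automatic and T₀ = 0 suffices.
  have hT : 1 ≤ T := by
    have := hf.lt_of_lt (i := 0) (j := N + 1) (by omega) le_rfl
    rw [hf.r_zero, hf.r_last] at this
    omega
  have hlog := logTd_nonneg hT hd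
  have hc : 0 ≤ 4 * σ * √(logTd T d) := by positivity
  have hsub : {ω | CusumBounded T (fun t k => ε t ω k) (4 * σ * √(logTd T d))} ⊆ {ω |
      LargestDiffCondition n L (X ω) lam ζ T N r →
        Recovers L (X ω) (mdais L (X ω) lam ζ 1 T) N r f (128 * σ ^ 2 * logTd T d)} := by
    intro ω hω hA
    have hreg : DetectionRegime n L f (fun t k => ε t ω k) T N r lam ζ
        (4 * σ * √(logTd T d)) :=
      { three_halves_le := hn
        signal := hf
        noise_nonneg := hc
        noise := hω
        lam_pos := hlam
        lam_le := hlam'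
        le_threshold := by linarith
        threshold_lt := fun j h1 h2 =>
          threshold_add_noise_lt hn hsig hζ' h1 h2 }
    have := hreg.recovers hA
    rwa [mul_pow, Real.sq_sqrt hlog,
      show 8 * ((4 * σ) ^ 2 * logTd T d) = 128 * σ ^ 2 * logTd T d by ring] at this
  refine le_trans ?_ (measureReal_mono hsub)
  have hbad := measureReal_not_cusumBounded_le hS hSσ hlaw hind hc
  rw [show -(4 * σ * √(logTd T d)) ^ 2 / (2 * σ ^ 2) = -(8 * logTd T d) by
    rw [mul_pow, Real.sq_sqrt hlog]; field_simp; ring] at hbad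
  have hbad' := hbad.trans (union_bound_le hT hd)
  -- Subadditivity replaces the complement rule, so no event has to be shown measurable.
  have huniv := measureReal_union_le (μ := P)
    {ω | CusumBounded T (fun t k => ε t ω k) (4 * σ * √(logTd T d))}
    {ω | ¬ CusumBounded T (fun t k => ε t ω k) (4 * σ * √(logTd T d))}
  have : {ω | CusumBounded T (fun t k => ε t ω k) (4 * σ * √(logTd T d))} ∪
      {ω | ¬ CusumBounded T (fun t k => ε t ω k) (4 * σ * √(logTd T d))} = Set.univ :=
    Set.union_compl_self _
  rw [this, probReal_univ] at huniv
  linarith
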